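/- Let $\Gamma_0^*(2) := \Gamma_0(2)\cup\Gamma_0(2)W_2\subset \mathrm{SL}_2(\mathbb{R})$, where $\Gamma_0(2)=\{\left(\begin{smallmatrix}a&b\\c&d\end{smallmatrix}\right)\in \mathrm{SL}_2(\mathbb{Z}) : c\equiv 0 \pmod 2\}$ and $W_2=\left(\begin{smallmatrix}0&-1/\sqrt2\\ \sqrt2&0\end{smallmatrix}\right)$; it acts on the upper half-plane $\mathbb{H}$ by Möbius transformations. Let $k$ be an integer. A modular function of weight $k$ for $\Gamma_0^*(2)$ is a meromorphic function $f$ on $\mathbb{H}$ such that $f(\gamma z)=(cz+d)^k f(z)$ for all $\gamma=\left(\begin{smallmatrix}a&b\\c&d\end{smallmatrix}\right)\in\Gamma_0^*(2)$ and all $z \in \mathbb{H}$, and such that $f$, as a function of $q=e^{2\pi i z}$, is meromorphic at $q=0$. For $p\in\mathbb{H}$ let $v_p(f)$ be the order of $f$ at $p$, and let $v_\infty(f)$ be the order at $q=0$ of $f$ as a function of $q$. Let $f$ be a modular function of weight $k$ for $\Gamma_0^*(2)$ that is not identically zero. Then all the orders $v_\infty(f)$ and $v_p(f)$ are finite, $v_p(f)$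 depends only on the orbit of $p$ under $\Gamma_0^*(2)$, it is nonzero for only finitely many orbits, and $$v_\infty(f)+\frac12\, v_{i/\sqrt2}(f)+\frac14\, v_{\rho_2}(f)+\sum_{p} v_p(f)=\frac{k}{8},$$ where $\rho_2:=e^{3\pi i/4}/\sqrt2$ and the sum is over all orbits $p\in\Gamma_0^*(2)\backslash\mathbb{H}$ other than those of $i/\sqrt2$ and $\rho_2$. -/

import Mathlib

open UpperHalfPlane
open scoped MatrixGroups

noncomputable section

namespace Fricke

/-- The image of `Γ₀(p)` in `SL(2, ℝ)`. -/
def gamma0Real (p : ℕ) : Subgroup SL(2, ℝ) :=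
  (CongruenceSubgroup.Gamma0 p).map (Matrix.SpecialLinearGroup.map (Int.castRingHom ℝ))

/-- The matrix `W_p = (0, -1/√p; √p, 0)`. -/
def W (p : ℕ) [Fact p.Prime] : SL(2, ℝ) :=
  ⟨!![0, -1 / √(p : ℝ); √(p : ℝ), 0], by
    have hp : (0 : ℝ) < p := by exact_mod_cast (Fact.out : p.Prime).pos
    have h : √(p : ℝ) ≠ 0 := (Real.sqrt_pos.mpr hp).ne'
    rw [Matrix.det_fin_two_of]
    field_simp
    ring⟩

lemma coe_W (p : ℕ) [Fact p.Prime] :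
    (W p : Matrix (Fin 2) (Fin 2) ℝ) = !![0, -1 / √(p : ℝ); √(p : ℝ), 0] := rfl

lemma W_mul_W (p : ℕ) [Fact p.Prime] : W p * W p = -1 := by
  have hp : (0 : ℝ) < p := by exact_mod_cast (Fact.out : p.Prime).pos
  have h : √(p : ℝ) ≠ 0 := (Real.sqrt_pos.mpr hp).ne'
  ext i j
  rw [Matrix.SpecialLinearGroup.coe_mul, coe_W]
  fin_cases i <;> fin_cases j <;> simp <;> field_simp

lemma neg_one_mem_gamma0Real (p : ℕ) : (-1 : SL(2, ℝ)) ∈ gamma0Real p := by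
  refine ⟨-1, by simp [CongruenceSubgroup.Gamma0_mem], ?_⟩
  ext i j
  fin_cases i <;> fin_cases j <;> simp

lemma W_mul_mem (p : ℕ) [Fact p.Prime] {g : SL(2, ℝ)} (hg : g ∈ gamma0Real p) :
    ∃ g' ∈ gamma0Real p, W p * g = g' * W p := by
  have hp : (0 : ℝ) < p := by exact_mod_cast (Fact.out : p.Prime).pos
  have h : √(p : ℝ) ≠ 0 := (Real.sqrt_pos.mpr hp).ne'
  have hs : √(p : ℝ) ^ 2 = p := Real.sq_sqrt hp.le
  obtain ⟨γ, hγ, rfl⟩ := hg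
  obtain ⟨c, hc⟩ := (ZMod.intCast_zmod_eq_zero_iff_dvd (γ 1 0) p).mp
    (CongruenceSubgroup.Gamma0_mem.mp hγ)
  have hd : γ 0 0 * γ 1 1 - γ 0 1 * (p * c) = 1 := by
    rw [← hc, ← Matrix.det_fin_two, γ.det_coe]
  obtain ⟨δ, h00, h01, h10, h11⟩ : ∃ δ : SL(2, ℤ),
      δ 0 0 = γ 1 1 ∧ δ 0 1 = -c ∧ δ 1 0 = -(p * γ 0 1) ∧ δ 1 1 = γ 0 0 :=
    ⟨⟨!![γ 1 1, -c; -(p * γ 0 1), γ 0 0], by rw [Matrix.det_fin_two_of]; linarith⟩,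
      rfl, rfl, rfl, rfl⟩
  refine ⟨_, ⟨δ, CongruenceSubgroup.Gamma0_mem.mpr (by rw [h10]; simp), rfl⟩, ?_⟩
  have hcr : ((γ 1 0 : ℤ) : ℝ) = p * c := by rw [hc]; push_cast; ring
  ext i j
  rw [Matrix.SpecialLinearGroup.coe_mul, Matrix.SpecialLinearGroup.coe_mul, coe_W]
  fin_cases i <;> fin_cases j <;>
    simp [Matrix.mul_apply, Fin.sum_univ_two, hcr, h00, h01, h10, h11] <;> field_simp <;>
    simp [hs, mul_comm]

/-- The Fricke group `Γ₀*(p) = Γ₀(p) ∪ Γ₀(p) W_p`, a subgroup of `SL(2, ℝ)`. -/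
def Gamma0Star (p : ℕ) [Fact p.Prime] : Subgroup SL(2, ℝ) where
  carrier := {g | g ∈ gamma0Real p ∨ ∃ h ∈ gamma0Real p, g = h * W p}
  one_mem' := Or.inl (one_mem _)
  mul_mem' := by
    rintro a b (ha | ⟨a, ha, rfl⟩) (hb | ⟨b, hb, rfl⟩)
    · exact Or.inl (mul_mem ha hb)
    · exact Or.inr ⟨a * b, mul_mem ha hb, (mul_assoc _ _ _).symm⟩
    · obtain ⟨b', hb', h⟩ := W_mul_mem p hb
      exact Or.inr ⟨a * b', mul_mem ha hb', by rw [mul_assoc, h, mul_assoc]⟩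
    · obtain ⟨b', hb', h⟩ := W_mul_mem p hb
      refine Or.inl ?_
      have : a * W p * (b * W p) = a * b' * -1 := by
        rw [← W_mul_W p, mul_assoc a, ← mul_assoc (W p), h]
        simp only [mul_assoc]
      rw [this]
      exact mul_mem (mul_mem ha hb') (neg_one_mem_gamma0Real p)
  inv_mem' := by
    rintro a (ha | ⟨a, ha, rfl⟩)
    · exact Or.inl (inv_mem ha)
    · obtain ⟨b, hb, h⟩ := W_mul_mem p (inv_mem ha)
      refine Or.inr ⟨-1 * b, mul_mem (neg_one_mem_gamma0Real p) hb, ?_⟩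
      have hW : (W p)⁻¹ = -1 * W p := by
        rw [inv_eq_iff_mul_eq_one, neg_one_mul, mul_neg, W_mul_W, neg_neg]
      rw [mul_inv_rev, hW, mul_assoc, h, mul_assoc]

/-- The order `v_z(f) ∈ ℤ ∪ {∞}` at a point `z` of the upper half-plane of a function `f` that is
meromorphic there. -/
def orderAt (f : ℍ → ℂ) (z : ℍ) : WithTop ℤ :=
  meromorphicOrderAt (f ∘ ofComplex) (z : ℂ)

/-- The order `v_∞(f) ∈ ℤ ∪ {∞}`: the order at `q = 0` of `f` as a function of
`q = exp (2πiz)`. -/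
def orderAtInfty (f : ℍ → ℂ) : WithTop ℤ :=
  meromorphicOrderAt (cuspFunction 1 f) 0

/-- `f` is a modular function of weight `k` for `Γ₀*(p)`: it is meromorphic on the upper half-plane,
it satisfies `f (γ z) = (c z + d) ^ k f z` for all `γ = (a, b; c, d)` in `Γ₀*(p)`, and it is
meromorphic at `∞`, that is, as a function of `q = exp (2πiz)` at `q = 0`.

As usual for meromorphic functions in Mathlib, `f` carries a value at its poles too; the value `0`
there satisfies the transformation rule. -/
structure IsModularFunction (p : ℕ) [Fact p.Prime] (k : ℤ) (f : ℍ → ℂ) : Prop where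
  meromorphicAt : ∀ z : ℍ, MeromorphicAt (f ∘ ofComplex) (z : ℂ)
  transform : ∀ γ ∈ Gamma0Star p, ∀ z : ℍ,
    f (γ • z) = (((γ 1 0 : ℝ) : ℂ) * (z : ℂ) + ((γ 1 1 : ℝ) : ℂ)) ^ k * f z
  meromorphicAt_infty : MeromorphicAt (cuspFunction 1 f) 0

/-- The set of orbits `Γ₀*(p) \ ℍ`. -/
abbrev Orbits (p : ℕ) [Fact p.Prime] : Type :=
  MulAction.orbitRel.Quotient (Gamma0Star p) ℍ

/-- The orbit of a point. -/
def orbit (p : ℕ) [Fact p.Prime] (z : ℍ) : Orbits p :=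
  Quotient.mk _ z

/-- The order of `f` on an orbit, read off at a representative. -/
def orderOnOrbit (p : ℕ) [Fact p.Prime] (f : ℍ → ℂ) (x : Orbits p) : WithTop ℤ :=
  orderAt f (Quotient.out x)

/-- The elliptic point `i / √2`. -/
def iPoint : ℍ :=
  ⟨Complex.I / (√2 : ℝ), by simp [Complex.div_ofReal_im]⟩

/-- The elliptic point `ρ₂ = exp (3πi/4) / √2`. -/
def rhoPoint : ℍ :=
  ⟨Complex.exp (Complex.I * (3 * Real.pi / 4 : ℝ)) / (√2 : ℝ), by
    rw [Complex.div_ofReal_im, mul_comm, Complex.exp_ofReal_mul_I_im]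
    exact div_pos (Real.sin_pos_of_pos_of_lt_pi (by positivity) (by linarith [Real.pi_pos]))
      (by positivity)⟩

end Fricke

end

/-! The formula comes from comparing `f` with explicit functions rather than from a contour
integral. In the coordinate q, orders on ℍ become orders of `cuspFunction 1 f` on the unit disc,
with ∞ at the centre (`orderAt_eq`). Every orbit meets Im z ≥ 1/4, that is, a compact subdisc. The
maximum principle therefore shows that a weight 0 function with no zeros or poles on ℍ has order 0
at ∞ (`orderAtInfty_eq_zero`).

The form Δ(z)Δ(2z) has weight 24, order 3 at ∞ and no zeros on ℍ. Dividing the square of `eisForm`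
by it gives a weight 0 function t (`hauptmodul`), holomorphic on ℍ with a simple pole at ∞. It
separates orbits (`orbit_eq_of_hauptmodul_eq`), so t − t(x) vanishes only on the orbit x, to some
order e_x ≥ 1 (`ramification`). A power of `f`, divided by suitable powers of Δ(z)Δ(2z) and of the t
− t(x), has weight 0 and no zeros or poles on ℍ. Its order at ∞ is thus 0, which says v_∞(f) + ∑
v_x(f)/e_x = k/8 (`valence_ramification`).

It remains to find the e_x. The derivative t' has weight 2, order −1 at ∞ and order e_x − 1 on x, so
the same formula gives ∑ (1 − 1/e_x) = 5/4. Stabilizers force 2 ∣ e at i/√2 and 4 ∣ e at ρ₂. These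
two orbits already contribute at least 1/2 + 3/4 = 5/4, so the indices there are exactly 2 and 4,
and every other index is 1 (`ramification_eq`). -/

noncomputable section

namespace Fricke

open Filter Topology Set Function

local notation "𝕢" => Function.Periodic.qParam (1 : ℝ)

/-! ### The action of Γ₀*(2) on ℍ and its elliptic points -/

section

open scoped Pointwise

lemma coe_smul (γ : SL(2, ℝ)) (z : ℍ) :
    ((γ • z : ℍ) : ℂ) = (((γ 0 0 : ℝ) : ℂ) * z + ((γ 0 1 : ℝ) : ℂ)) /
      (((γ 1 0 : ℝ) : ℂ) * z + ((γ 1 1 : ℝ) : ℂ)) :=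
  coe_specialLinearGroup_apply γ z

lemma denom_ne_zero' (γ : SL(2, ℝ)) (z : ℍ) :
    ((γ 1 0 : ℝ) : ℂ) * z + ((γ 1 1 : ℝ) : ℂ) ≠ 0 :=
  UpperHalfPlane.denom_ne_zero (γ : GL (Fin 2) ℝ) z

lemma im_smul (γ : SL(2, ℝ)) (z : ℍ) :
    (γ • z).im = z.im / Complex.normSq (((γ 1 0 : ℝ) : ℂ) * z + ((γ 1 1 : ℝ) : ℂ)) := by
  have := UpperHalfPlane.im_smul_eq_div_normSq (γ : GL (Fin 2) ℝ) z
  simp at this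
  exact this

/-- The translation `z ↦ z + n`. -/
def translation (n : ℤ) : SL(2, ℝ) :=
  Matrix.SpecialLinearGroup.map (Int.castRingHom ℝ) (ModularGroup.T ^ n)

lemma coe_translation (n : ℤ) :
    (translation n : Matrix (Fin 2) (Fin 2) ℝ) = !![1, (n : ℝ); 0, 1] := by
  rw [translation, Matrix.SpecialLinearGroup.map_apply_coe, ModularGroup.coe_T_zpow]
  ext i j
  fin_cases i <;> fin_cases j <;> simp

lemma map_mem_Gamma0Star {γ : SL(2, ℤ)} (hγ : γ ∈ CongruenceSubgroup.Gamma0 2) :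
    Matrix.SpecialLinearGroup.map (Int.castRingHom ℝ) γ ∈ Gamma0Star 2 :=
  Or.inl ⟨γ, hγ, rfl⟩

lemma W_mem : W 2 ∈ Gamma0Star 2 := Or.inr ⟨1, one_mem _, by simp⟩

lemma translation_mem (n : ℤ) : translation n ∈ Gamma0Star 2 :=
  map_mem_Gamma0Star (by simp [CongruenceSubgroup.Gamma0_mem, ModularGroup.coe_T_zpow])

/-- The matrices of `Γ₀(2)` act as the corresponding integral matrices. -/
lemma map_smul (γ : SL(2, ℤ)) (z : ℍ) :
    Matrix.SpecialLinearGroup.map (Int.castRingHom ℝ) γ • z = γ • z := by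
  ext
  rw [coe_smul, coe_specialLinearGroup_apply]
  simp

lemma coe_translation_smul (n : ℤ) (z : ℍ) : ((translation n • z : ℍ) : ℂ) = z + n := by
  rw [translation, map_smul, modular_T_zpow_smul, coe_vadd, add_comm]
  simp

lemma coe_W_smul (z : ℍ) : ((W 2 • z : ℍ) : ℂ) = -1 / (2 * z) := by
  have h2 : ((√2 : ℝ) : ℂ) ^ 2 = 2 := by exact_mod_cast Real.sq_sqrt (by norm_num : (0 : ℝ) ≤ 2)
  have h0 : ((√2 : ℝ) : ℂ) ≠ 0 := by intro h; simp [h] at h2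
  have hz := z.ne_zero
  rw [coe_smul]
  simp [coe_W]
  field_simp
  rw [h2]

/-- Inherited from SL(2, ℤ) through Γ₀(2); elements of the coset of W₂ that move K to meet L come
from elements of Γ₀(2) that move W₂K to meet L. This makes the orbit space Hausdorff. -/
instance : ProperlyDiscontinuousSMul (Gamma0Star 2) ℍ := by
  have h0 : ProperlyDiscontinuousSMul (gamma0Real 2) ℍ := by
    refine Subgroup.properlyDiscontinuousSMul_of_le
      (G := (Matrix.SpecialLinearGroup.map (n := Fin 2) (Int.castRingHom ℝ)).range) inferInstance ?_
    exact Subgroup.map_le_range _ _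
  rw [Subgroup.properlyDiscontinuousSMul_iff] at h0 ⊢
  intro K L hK hL
  have hWK : IsCompact (W 2 • K) := hK.image (continuous_const_smul (W 2))
  refine ((h0 hK hL).union ((h0 hWK hL).image (· * W 2))).subset ?_
  rintro g ⟨hg | ⟨h, hh, rfl⟩, hne⟩
  · exact Or.inl ⟨hg, hne⟩
  · exact Or.inr ⟨h, ⟨hh, by rwa [smul_smul]⟩, rfl⟩

/-- Every point is equivalent to one with imaginary part at least `1 / 4`. -/
lemma exists_smul_im_ge (z : ℍ) : ∃ γ ∈ Gamma0Star 2, 1 / 4 ≤ (γ • z).im := by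
  obtain ⟨δ, hδ⟩ := ModularGroup.exists_one_half_le_im_smul z
  by_cases hc : (2 : ℤ) ∣ δ 1 0
  · refine ⟨_, map_mem_Gamma0Star (γ := δ) ?_, ?_⟩
    · rw [CongruenceSubgroup.Gamma0_mem]
      exact (ZMod.intCast_zmod_eq_zero_iff_dvd _ 2).mpr hc
    · rw [map_smul]; linarith
  -- When the lower left entry of δ is odd, a translation makes the upper left entry even. Then z ↦
  -- (δz + n)/2 is given by ε W₂ with ε in Γ₀(2); the halving turns the bound 1/2 into 1/4.
  · obtain ⟨n, a, ha⟩ : ∃ n a : ℤ, δ 0 0 + n * δ 1 0 = 2 * a := by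
      rcases Int.even_or_odd (δ 0 0) with ⟨b, hb⟩ | ⟨b, hb⟩
      · exact ⟨0, b, by rw [hb]; ring⟩
      · obtain ⟨c, hc'⟩ := Int.not_even_iff_odd.mp (fun h => hc h.two_dvd)
        exact ⟨1, b + c + 1, by rw [hb, hc']; ring⟩
    have hdet : δ 0 0 * δ 1 1 - δ 0 1 * δ 1 0 = 1 := by
      rw [← Matrix.det_fin_two, δ.det_coe]
    obtain ⟨ε, h00, h01, h10, h11⟩ : ∃ ε : SL(2, ℤ), ε 0 0 = δ 0 1 + n * δ 1 1 ∧ ε 0 1 = - a ∧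
        ε 1 0 = 2 * δ 1 1 ∧ ε 1 1 = - δ 1 0 := by
      refine ⟨⟨!![δ 0 1 + n * δ 1 1, -a; 2 * δ 1 1, -δ 1 0], ?_⟩, rfl, rfl, rfl, rfl⟩
      rw [Matrix.det_fin_two_of]
      linear_combination hdet + (δ 1 1) * (-1 : ℤ) * ha
    have hε : ε ∈ CongruenceSubgroup.Gamma0 2 := by
      rw [CongruenceSubgroup.Gamma0_mem, h10]
      exact (ZMod.intCast_zmod_eq_zero_iff_dvd _ 2).mpr ⟨_, rfl⟩
    refine ⟨_, Or.inr ⟨_, ⟨ε, hε, rfl⟩, rfl⟩, ?_⟩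
    have hn : Complex.normSq ((((Matrix.SpecialLinearGroup.map (Int.castRingHom ℝ) ε * W 2) 1 0 : ℝ)
        : ℂ) * z + (((Matrix.SpecialLinearGroup.map (Int.castRingHom ℝ) ε * W 2) 1 1 : ℝ) : ℂ)) =
        2 * Complex.normSq (((δ 1 0 : ℤ) : ℂ) * z + ((δ 1 1 : ℤ) : ℂ)) := by
      have e0 : (Matrix.SpecialLinearGroup.map (Int.castRingHom ℝ) ε * W 2) 1 0 =
          -(√2 * (δ 1 0 : ℝ)) := by
        rw [Matrix.SpecialLinearGroup.coe_mul, coe_W]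
        simp [Matrix.mul_apply, Fin.sum_univ_two, h11, mul_comm]
      have e1 : (Matrix.SpecialLinearGroup.map (Int.castRingHom ℝ) ε * W 2) 1 1 =
          -(√2 * (δ 1 1 : ℝ)) := by
        rw [Matrix.SpecialLinearGroup.coe_mul, coe_W]
        simp [Matrix.mul_apply, Fin.sum_univ_two, h10]
        field_simp
        rw [Real.sq_sqrt (by norm_num)]
        ring
      have h2 : (2 : ℝ) = Complex.normSq (-((√2 : ℝ) : ℂ)) := by simp
      rw [e0, e1]
      conv_rhs => rw [h2]
      rw [← map_mul]
      congr 1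
      push_cast
      ring
    rw [ModularGroup.im_smul_eq_div_normSq, ModularGroup.denom_apply] at hδ
    rw [im_smul, hn, mul_comm, ← div_div]
    linarith

lemma exists_smul_mem_strip (z : ℍ) :
    ∃ γ ∈ Gamma0Star 2, 1 / 4 ≤ (γ • z).im ∧ |(γ • z).re| ≤ 1 / 2 := by
  obtain ⟨γ, hγ, h⟩ := exists_smul_im_ge z
  have key : ((translation (-round (γ • z).re) * γ) • z : ℍ) =
    translation (-round (γ • z).re) • (γ • z) := mul_smul _ _ _
  have hc := coe_translation_smul (-round (γ • z).re) (γ • z)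
  refine ⟨_, mul_mem (translation_mem (-round (γ • z).re)) hγ, ?_, ?_⟩
  · rw [key, ← coe_im, hc]; simpa using h
  · rw [key, ← coe_re, hc]; simpa [← sub_eq_add_neg] using abs_sub_round (γ • z).re

/-- Two points lie in the same orbit if and only if an element of the group carries one to the other. -/
lemma orbit_eq_iff {z w : ℍ} : orbit 2 z = orbit 2 w ↔ ∃ γ ∈ Gamma0Star 2, γ • w = z := by
  unfold orbit
  rw [Quotient.eq, MulAction.orbitRel_apply]
  constructor
  · rintro ⟨⟨γ, hγ⟩, rfl⟩; exact ⟨γ, hγ, rfl⟩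
  · rintro ⟨γ, hγ, rfl⟩; exact ⟨⟨γ, hγ⟩, rfl⟩

lemma orbit_smul {γ : SL(2, ℝ)} (hγ : γ ∈ Gamma0Star 2) (z : ℍ) : orbit 2 (γ • z) = orbit 2 z :=
  orbit_eq_iff.mpr ⟨γ, hγ, rfl⟩

lemma orbit_out (x : Orbits 2) : orbit 2 (Quotient.out x) = x := Quotient.out_eq x

lemma coe_iPoint : (iPoint : ℂ) = Complex.I / (√2 : ℝ) := rfl

lemma coe_rhoPoint : (rhoPoint : ℂ) = (-1 + Complex.I) / 2 := by
  have h2 : ((√2 : ℝ) : ℂ) ^ 2 = 2 := by exact_mod_cast Real.sq_sqrt (by norm_num : (0 : ℝ) ≤ 2)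
  have h0 : ((√2 : ℝ) : ℂ) ≠ 0 := by intro h; simp [h] at h2
  have hc : Real.cos (3 * Real.pi / 4) = -(√2 / 2) := by
    rw [show 3 * Real.pi / 4 = Real.pi - Real.pi / 4 by ring, Real.cos_pi_sub, Real.cos_pi_div_four]
  have hs : Real.sin (3 * Real.pi / 4) = √2 / 2 := by
    rw [show 3 * Real.pi / 4 = Real.pi - Real.pi / 4 by ring, Real.sin_pi_sub, Real.sin_pi_div_four]
  change Complex.exp (Complex.I * (3 * Real.pi / 4 : ℝ)) / (√2 : ℝ) = _
  rw [mul_comm, Complex.exp_mul_I, ← Complex.ofReal_cos, ← Complex.ofReal_sin, hc, hs]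
  push_cast
  field_simp

lemma W_smul_iPoint : W 2 • iPoint = iPoint := by
  have h2 : ((√2 : ℝ) : ℂ) ^ 2 = 2 := by exact_mod_cast Real.sq_sqrt (by norm_num : (0 : ℝ) ≤ 2)
  have h0 : ((√2 : ℝ) : ℂ) ≠ 0 := by intro h; simp [h] at h2
  ext
  rw [coe_W_smul, coe_iPoint]
  field_simp
  linear_combination -h2 - 2 * Complex.I_sq

lemma translation_W_smul_rhoPoint : (translation (-1) * W 2) • rhoPoint = rhoPoint := by
  have hI : (-1 + Complex.I) ≠ 0 := fun h => by simpa using congrArg Complex.re h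
  have hk : (translation (-1) * W 2) • rhoPoint = translation (-1) • W 2 • rhoPoint :=
    mul_smul _ _ _
  ext
  rw [hk, coe_translation_smul, coe_W_smul, coe_rhoPoint]
  field_simp
  linear_combination - Complex.I_sq

/-- All points in the orbit of ρ₂ have rational imaginary part: |cρ₂ + d|² is rational even on the
coset of W₂, where the factors √2 occur only in squares or cancel. But Im(i/√2) is irrational. -/
lemma orbit_iPoint_ne_orbit_rhoPoint : orbit 2 iPoint ≠ orbit 2 rhoPoint := by
  intro h
  obtain ⟨γ, hγ, h⟩ := orbit_eq_iff.mp h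
  have him := congrArg UpperHalfPlane.im h
  rw [im_smul] at him
  have hi : iPoint.im = 1 / √2 := by rw [← coe_im, coe_iPoint]; simp [Complex.div_ofReal_im]
  have hr : rhoPoint.im = 1 / 2 := by rw [← coe_im, coe_rhoPoint]; simp
  have hn : Complex.normSq (((γ 1 0 : ℝ) : ℂ) * rhoPoint + ((γ 1 1 : ℝ) : ℂ)) =
      γ 1 1 ^ 2 - γ 1 0 * γ 1 1 + γ 1 0 ^ 2 / 2 := by
    rw [coe_rhoPoint, Complex.normSq_apply]
    simp
    ring
  obtain ⟨r, hr'⟩ : ∃ r : ℚ, γ 1 1 ^ 2 - γ 1 0 * γ 1 1 + γ 1 0 ^ 2 / 2 = (r : ℝ) := by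
    rcases hγ with ⟨δ, -, rfl⟩ | ⟨_, ⟨δ, -, rfl⟩, rfl⟩
    · exact ⟨δ 1 1 ^ 2 - δ 1 0 * δ 1 1 + δ 1 0 ^ 2 / 2, by simp⟩
    · refine ⟨δ 1 0 ^ 2 / 2 + δ 1 0 * δ 1 1 + δ 1 1 ^ 2, ?_⟩
      have hs : √2 ^ 2 = 2 := Real.sq_sqrt (by norm_num : (0 : ℝ) ≤ 2)
      have h0 : √2 ≠ 0 := by intro h; simp at h
      rw [Matrix.SpecialLinearGroup.coe_mul, coe_W]
      simp [Matrix.mul_apply, Fin.sum_univ_two]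
      field_simp
      have hs4 : √2 ^ 4 = 4 := by rw [show 4 = 2 * 2 from rfl, pow_mul, hs]; norm_num
      ring_nf
      rw [hs4, hs]
      ring
  rw [hn, hr', hi, hr] at him
  refine (irrational_sqrt_two.ne_rat (2 * r)) ?_
  have h0 : √2 ≠ 0 := by intro h; simp at h
  have hr0 : (r : ℝ) ≠ 0 := by
    rintro h; rw [h] at him; simp at him; exact h0 him.symm
  field_simp at him
  push_cast
  linarith

end

/-! ### Orders of modular functions -/

section

lemma eventually_im_pos (z : ℍ) : ∀ᶠ w in 𝓝 (z : ℂ), 0 < w.im :=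
  isOpen_upperHalfPlaneSet.mem_nhds z.im_pos

/-- The Möbius transformation of a matrix has derivative `(c z + d) ^ (-2)`. -/
lemma hasStrictDerivAt_smul (γ : SL(2, ℝ)) (z : ℍ) :
    HasStrictDerivAt (fun w : ℂ => ((γ • ofComplex w : ℍ) : ℂ))
      ((((γ 1 0 : ℝ) : ℂ) * z + ((γ 1 1 : ℝ) : ℂ)) ^ 2)⁻¹ (z : ℂ) := by
  have hne := denom_ne_zero' γ z
  have hdet : ((γ 0 0 : ℝ) : ℂ) * (γ 1 1 : ℝ) - (γ 0 1 : ℝ) * (γ 1 0 : ℝ) = 1 := by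
    have := γ.det_coe
    rw [Matrix.det_fin_two] at this
    exact_mod_cast this
  have h1 : HasStrictDerivAt (fun w : ℂ => ((γ 0 0 : ℝ) : ℂ) * w + ((γ 0 1 : ℝ) : ℂ))
      ((γ 0 0 : ℝ) : ℂ) (z : ℂ) := by
    simpa using ((hasStrictDerivAt_id (z : ℂ)).const_mul ((γ 0 0 : ℝ) : ℂ)).add_const
      ((γ 0 1 : ℝ) : ℂ)
  have h2 : HasStrictDerivAt (fun w : ℂ => ((γ 1 0 : ℝ) : ℂ) * w + ((γ 1 1 : ℝ) : ℂ))
      ((γ 1 0 : ℝ) : ℂ) (z : ℂ) := by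
    simpa using ((hasStrictDerivAt_id (z : ℂ)).const_mul ((γ 1 0 : ℝ) : ℂ)).add_const
      ((γ 1 1 : ℝ) : ℂ)
  have h3 := h1.div h2 hne
  have e : (((γ 0 0 : ℝ) : ℂ) * (((γ 1 0 : ℝ) : ℂ) * z + ((γ 1 1 : ℝ) : ℂ)) -
      (((γ 0 0 : ℝ) : ℂ) * z + ((γ 0 1 : ℝ) : ℂ)) * ((γ 1 0 : ℝ) : ℂ)) /
      (((γ 1 0 : ℝ) : ℂ) * z + ((γ 1 1 : ℝ) : ℂ)) ^ 2 =
      ((((γ 1 0 : ℝ) : ℂ) * z + ((γ 1 1 : ℝ) : ℂ)) ^ 2)⁻¹ := by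
    rw [div_eq_mul_inv]
    convert one_mul _ using 2
    linear_combination hdet
  rw [e] at h3
  refine h3.congr_of_eventuallyEq ?_
  filter_upwards [eventually_im_pos z] with w hw
  rw [coe_smul, ofComplex_apply_of_im_pos hw]
  simp

lemma analyticAt_smul (γ : SL(2, ℝ)) (z : ℍ) :
    AnalyticAt ℂ (fun w : ℂ => ((γ • ofComplex w : ℍ) : ℂ)) (z : ℂ) := by
  rw [Complex.analyticAt_iff_eventually_differentiableAt]
  filter_upwards [eventually_im_pos z] with w hw
  exact (hasStrictDerivAt_smul γ ⟨w, hw⟩).hasDerivAt.differentiableAt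

lemma deriv_smul_ne_zero (γ : SL(2, ℝ)) (z : ℍ) :
    deriv (fun w : ℂ => ((γ • ofComplex w : ℍ) : ℂ)) (z : ℂ) ≠ 0 := by
  rw [(hasStrictDerivAt_smul γ z).hasDerivAt.deriv]
  exact inv_ne_zero (pow_ne_zero _ (denom_ne_zero' γ z))

/-- The order of a composition with a Möbius transformation. -/
lemma orderAt_comp_smul (f : ℍ → ℂ) (γ : SL(2, ℝ)) (z : ℍ) :
    orderAt (fun w => f (γ • w)) z = orderAt f (γ • z) := by
  have := meromorphicOrderAt_comp_of_deriv_ne_zero (f := f ∘ ofComplex) (analyticAt_smul γ z)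
    (deriv_smul_ne_zero γ z)
  simp only [ofComplex_apply] at this
  rw [orderAt, orderAt, ← this]
  congr 1
  ext w
  simp

lemma analyticAt_denom_zpow (γ : SL(2, ℝ)) (k : ℤ) (z : ℍ) :
    AnalyticAt ℂ (fun w : ℂ => (((γ 1 0 : ℝ) : ℂ) * w + ((γ 1 1 : ℝ) : ℂ)) ^ k) (z : ℂ) := by
  refine AnalyticAt.fun_zpow (by fun_prop) (denom_ne_zero' γ z)

variable {p : ℕ} [Fact p.Prime] {k l : ℤ} {f g : ℍ → ℂ}

lemma IsModularFunction.orderAt_smul (hf : IsModularFunction p k f) {γ : SL(2, ℝ)}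
    (hγ : γ ∈ Gamma0Star p) (z : ℍ) : orderAt f (γ • z) = orderAt f z := by
  rw [← orderAt_comp_smul, orderAt, orderAt, ← meromorphicOrderAt_mul_of_ne_zero
    (f := f ∘ ofComplex) (analyticAt_denom_zpow γ k z) (zpow_ne_zero _ (denom_ne_zero' γ z))]
  apply meromorphicOrderAt_congr
  filter_upwards [(eventually_im_pos z).filter_mono nhdsWithin_le_nhds] with w hw
  simp [hf.transform γ hγ, ofComplex_apply_of_im_pos hw]

lemma cuspFunction_of_ne_zero (f : ℍ → ℂ) {q : ℂ} (hq : q ≠ 0) :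
    cuspFunction 1 f q = f (ofComplex (Function.Periodic.invQParam 1 q)) :=
  Function.Periodic.cuspFunction_eq_of_nonzero 1 _ hq

lemma eventually_cuspFunction_eq (f : ℍ → ℂ) : ∀ᶠ q in 𝓝[≠] (0 : ℂ),
    cuspFunction 1 f q = f (ofComplex (Function.Periodic.invQParam 1 q)) :=
  eventually_nhdsWithin_of_forall fun _ hq => cuspFunction_of_ne_zero f hq

lemma cuspFunction_mul_eventuallyEq (f g : ℍ → ℂ) :
    cuspFunction 1 (f * g) =ᶠ[𝓝[≠] 0] cuspFunction 1 f * cuspFunction 1 g := by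
  filter_upwards [self_mem_nhdsWithin] with q hq
  simp [cuspFunction_of_ne_zero _ hq]

lemma cuspFunction_zpow_eventuallyEq (f : ℍ → ℂ) (n : ℤ) :
    cuspFunction 1 (f ^ n) =ᶠ[𝓝[≠] 0] cuspFunction 1 f ^ n := by
  filter_upwards [self_mem_nhdsWithin] with q hq
  simp [cuspFunction_of_ne_zero _ hq]

lemma IsModularFunction.mul (hf : IsModularFunction p k f) (hg : IsModularFunction p l g) :
    IsModularFunction p (k + l) (f * g) where
  meromorphicAt z := (hf.meromorphicAt z).mul (hg.meromorphicAt z)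
  transform γ hγ z := by
    rw [Pi.mul_apply, Pi.mul_apply, hf.transform γ hγ, hg.transform γ hγ,
      zpow_add₀ (denom_ne_zero' γ z)]
    ring
  meromorphicAt_infty := (hf.meromorphicAt_infty.mul hg.meromorphicAt_infty).congr
    (cuspFunction_mul_eventuallyEq f g).symm

lemma IsModularFunction.zpow (hf : IsModularFunction p k f) (n : ℤ) :
    IsModularFunction p (k * n) (f ^ n) where
  meromorphicAt z := (hf.meromorphicAt z).zpow n
  transform γ hγ z := by
    rw [Pi.pow_apply, Pi.pow_apply, hf.transform γ hγ, mul_zpow, zpow_mul]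
  meromorphicAt_infty := (hf.meromorphicAt_infty.zpow n).congr
    (cuspFunction_zpow_eventuallyEq f n).symm

lemma IsModularFunction.orderAt_mul (hf : IsModularFunction p k f) (hg : IsModularFunction p l g)
    (z : ℍ) : orderAt (f * g) z = orderAt f z + orderAt g z :=
  meromorphicOrderAt_mul (hf.meromorphicAt z) (hg.meromorphicAt z)

lemma IsModularFunction.orderAt_zpow (hf : IsModularFunction p k f) (n : ℤ)
    (z : ℍ) : orderAt (f ^ n) z = n * orderAt f z :=
  meromorphicOrderAt_zpow (hf.meromorphicAt z)

lemma IsModularFunction.orderAtInfty_mul (hf : IsModularFunction p k f)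
    (hg : IsModularFunction p l g) :
    orderAtInfty (f * g) = orderAtInfty f + orderAtInfty g :=
  (meromorphicOrderAt_congr (cuspFunction_mul_eventuallyEq f g)).trans
    (meromorphicOrderAt_mul hf.meromorphicAt_infty hg.meromorphicAt_infty)

lemma IsModularFunction.orderAtInfty_zpow (hf : IsModularFunction p k f) (n : ℤ) :
    orderAtInfty (f ^ n) = n * orderAtInfty f :=
  (meromorphicOrderAt_congr (cuspFunction_zpow_eventuallyEq f n)).trans
    (meromorphicOrderAt_zpow hf.meromorphicAt_infty)

lemma IsModularFunction.one : IsModularFunction p 0 1 where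
  meromorphicAt z := MeromorphicAt.const 1 _
  transform γ hγ z := by simp
  meromorphicAt_infty := (MeromorphicAt.const 1 _).congr <| by
    filter_upwards [eventually_cuspFunction_eq 1] with q hq
    simp [hq]

lemma orderAt_one (z : ℍ) : orderAt 1 z = 0 := by
  classical
  exact (meromorphicOrderAt_const (z : ℂ) (1 : ℂ)).trans (by simp)

lemma orderAtInfty_one : orderAtInfty 1 = 0 := by
  classical
  refine (meromorphicOrderAt_congr (f₂ := fun _ => (1 : ℂ)) ?_).trans
    ((meromorphicOrderAt_const (0 : ℂ) (1 : ℂ)).trans (by simp))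
  filter_upwards [eventually_cuspFunction_eq 1] with q hq
  simp [hq]

section prod

variable {ι : Type*} {s : Finset ι} {F : ι → ℍ → ℂ}

lemma IsModularFunction.prod (h : ∀ i ∈ s, IsModularFunction p 0 (F i)) :
    IsModularFunction p 0 (∏ i ∈ s, F i) := by
  classical
  induction s using Finset.induction_on with
  | empty => simpa using IsModularFunction.one
  | insert a s ha ih =>
    rw [Finset.prod_insert ha]
    simpa using (h a (by simp)).mul (ih fun i hi => h i (by simp [hi]))

lemma IsModularFunction.orderAt_prod (h : ∀ i ∈ s, IsModularFunction p 0 (F i)) (z : ℍ) :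
    orderAt (∏ i ∈ s, F i) z = ∑ i ∈ s, orderAt (F i) z := by
  classical
  induction s using Finset.induction_on with
  | empty => simpa using orderAt_one z
  | insert a s ha ih =>
    have h' : ∀ i ∈ s, IsModularFunction p 0 (F i) := fun i hi => h i (by simp [hi])
    rw [Finset.prod_insert ha, Finset.sum_insert ha,
      (h a (by simp)).orderAt_mul (IsModularFunction.prod h'), ih h']

lemma IsModularFunction.orderAtInfty_prod (h : ∀ i ∈ s, IsModularFunction p 0 (F i)) :
    orderAtInfty (∏ i ∈ s, F i) = ∑ i ∈ s, orderAtInfty (F i) := by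
  classical
  induction s using Finset.induction_on with
  | empty => simpa using orderAtInfty_one
  | insert a s ha ih =>
    have h' : ∀ i ∈ s, IsModularFunction p 0 (F i) := fun i hi => h i (by simp [hi])
    rw [Finset.prod_insert ha, Finset.sum_insert ha,
      (h a (by simp)).orderAtInfty_mul (IsModularFunction.prod h'), ih h']

end prod

/-! ### The cusp function on the unit disc -/

lemma IsModularFunction.periodic (hf : IsModularFunction 2 k f) :
    Periodic (f ∘ ofComplex) (1 : ℝ) := by
  intro w
  by_cases hw : 0 < w.im
  · have h1 : 0 < (w + (1 : ℝ)).im := by simpa using hw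
    have := hf.transform (translation 1) (translation_mem 1) ⟨w, hw⟩
    simp only [comp_apply, ofComplex_apply_of_im_pos hw, ofComplex_apply_of_im_pos h1]
    have e : translation 1 • (⟨w, hw⟩ : ℍ) = ⟨w + (1 : ℝ), h1⟩ := by
      ext; rw [coe_translation_smul]; simp
    rw [e] at this
    rw [this]
    simp [coe_translation]
  · have h1 : (w + (1 : ℝ)).im ≤ 0 := by simpa using hw
    simp only [comp_apply, ofComplex_apply_of_im_nonpos (not_lt.mp hw),
      ofComplex_apply_of_im_nonpos h1]

lemma hasDerivAt_qParam (z : ℂ) :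
    HasDerivAt 𝕢 (2 * Real.pi * Complex.I * 𝕢 z) z := by
  have h := (((hasDerivAt_id z).const_mul (2 * Real.pi * Complex.I)).div_const
    ((1 : ℝ) : ℂ)).cexp
  convert! h using 1
  simp [Function.Periodic.qParam]
  ring

lemma deriv_qParam_ne_zero (z : ℂ) : deriv 𝕢 z ≠ 0 := by
  rw [(hasDerivAt_qParam z).deriv]
  exact mul_ne_zero Complex.two_pi_I_ne_zero (Complex.exp_ne_zero _)

lemma analyticAt_qParam (z : ℂ) : AnalyticAt ℂ 𝕢 z := by
  have : Differentiable ℂ 𝕢 := fun w => (hasDerivAt_qParam w).differentiableAt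
  exact this.analyticAt z

lemma cuspFunction_comp_qParam (hf : Periodic (f ∘ ofComplex) (1 : ℝ)) :
    cuspFunction 1 f ∘ 𝕢 = f ∘ ofComplex := by
  ext w
  exact Function.Periodic.eq_cuspFunction one_ne_zero hf w

lemma exists_qParam_eq {q : ℂ} (hq : ‖q‖ < 1) (hq0 : q ≠ 0) : ∃ z : ℍ, 𝕢 z = q :=
  ⟨⟨_, Function.Periodic.im_invQParam_pos_of_norm_lt_one one_pos hq hq0⟩,
    Function.Periodic.qParam_right_inv one_ne_zero hq0⟩

/-- The map z ↦ q has nowhere vanishing derivative, so it preserves orders. This puts ∞ and ℍ on the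
same footing, as points of one connected disc. -/
lemma orderAt_eq (hf : Periodic (f ∘ ofComplex) (1 : ℝ)) (z : ℍ) :
    orderAt f z = meromorphicOrderAt (cuspFunction 1 f) (𝕢 z) := by
  rw [orderAt, ← cuspFunction_comp_qParam hf]
  exact meromorphicOrderAt_comp_of_deriv_ne_zero (analyticAt_qParam _) (deriv_qParam_ne_zero _)

lemma IsModularFunction.meromorphicOn (hf : IsModularFunction 2 k f) :
    MeromorphicOn (cuspFunction 1 f) (Metric.ball 0 1) := by
  intro q hq
  by_cases h0 : q = 0
  · rw [h0]; exact hf.meromorphicAt_infty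
  obtain ⟨z, rfl⟩ := exists_qParam_eq (by simpa using hq) h0
  rw [← meromorphicAt_comp_iff_of_deriv_ne_zero (analyticAt_qParam _) (deriv_qParam_ne_zero _),
    cuspFunction_comp_qParam hf.periodic]
  exact hf.meromorphicAt z

lemma qParam_mem_ball (z : ℍ) : 𝕢 z ∈ Metric.ball (0 : ℂ) 1 := by
  simpa using Function.Periodic.norm_qParam_lt_one one_pos z.im_pos

lemma norm_qParam_le {y : ℝ} {z : ℍ} (h : y ≤ z.im) :
    ‖𝕢 (z : ℂ)‖ ≤ Real.exp (-2 * Real.pi * y) := by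
  rw [Function.Periodic.norm_qParam]
  have := Real.pi_pos
  simp
  gcongr

lemma IsModularFunction.orderAt_ne_top (hf : IsModularFunction 2 k f)
    (h : orderAtInfty f ≠ ⊤) (z : ℍ) : orderAt f z ≠ ⊤ := by
  rw [orderAt_eq hf.periodic]
  exact hf.meromorphicOn.meromorphicOrderAt_ne_top_of_isPreconnected
    (convex_ball 0 1).isPreconnected (by simp) (qParam_mem_ball z) h

/-- A nonzero modular function has finite orders. -/
lemma IsModularFunction.order_ne_top (hf : IsModularFunction 2 k f)
    (hf0 : ¬ f =ᶠ[codiscrete ℍ] 0) :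
    orderAtInfty f ≠ ⊤ ∧ ∀ z, orderAt f z ≠ ⊤ := by
  have hc : IsPreconnected (Metric.ball (0 : ℂ) 1) := (convex_ball 0 1).isPreconnected
  have key : ∀ q ∈ Metric.ball (0 : ℂ) 1, meromorphicOrderAt (cuspFunction 1 f) q ≠ ⊤ := by
    by_contra! H
    obtain ⟨q, hq, hq'⟩ := H
    -- By the identity principle on the connected disc, infinite order at one point spreads to all
    -- of ℍ.
    have hall : ∀ z, orderAt f z = ⊤ := by
      intro z
      by_contra hz
      rw [orderAt_eq hf.periodic] at hz
      exact hf.meromorphicOn.meromorphicOrderAt_ne_top_of_isPreconnected hc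
        (qParam_mem_ball z) hq hz hq'
    apply hf0
    rw [EventuallyEq, Filter.Eventually, mem_codiscrete]
    intro z
    rw [disjoint_principal_right, compl_compl]
    have h1 : ∀ᶠ w in 𝓝[≠] (z : ℂ), (f ∘ ofComplex) w = 0 := meromorphicOrderAt_eq_top_iff.mp (hall z)
    have h2 : Tendsto ((↑) : ℍ → ℂ) (𝓝[≠] z) (𝓝[≠] (z : ℂ)) :=
      continuous_coe.continuousAt.tendsto.inf
        (tendsto_principal_principal.mpr fun w hw h => hw (UpperHalfPlane.ext h))
    filter_upwards [h2.eventually h1] with w hw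
    simpa using hw
  refine ⟨key 0 (by simp), fun z => ?_⟩
  rw [orderAt_eq hf.periodic]
  exact key _ (qParam_mem_ball z)

lemma orbit_eq_of_qParam_eq {z w : ℍ} (h : 𝕢 (z : ℂ) = 𝕢 (w : ℂ)) : orbit 2 z = orbit 2 w := by
  obtain ⟨m, hm⟩ := Function.Periodic.qParam_left_inv_mod_period one_ne_zero (z : ℂ)
  obtain ⟨n, hn⟩ := Function.Periodic.qParam_left_inv_mod_period one_ne_zero (w : ℂ)
  refine orbit_eq_iff.mpr ⟨translation (n - m), translation_mem _, ?_⟩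
  ext
  rw [coe_translation_smul]
  rw [h, hn] at hm
  push_cast at hm ⊢
  linear_combination hm

lemma IsModularFunction.orderOnOrbit_orbit (hf : IsModularFunction 2 k f) (z : ℍ) :
    orderOnOrbit 2 f (orbit 2 z) = orderAt f z := by
  obtain ⟨γ, hγ, h⟩ := orbit_eq_iff.mp (orbit_out (orbit 2 z))
  rw [orderOnOrbit, ← h, hf.orderAt_smul hγ]

/-- Every orbit has a representative with Im z ≥ 1/4, hence |q| ≤ e^(−π/2) < 1. On this compact disc
the divisor of the cusp function has finite support. -/
lemma IsModularFunction.finite_order_ne_zero (hf : IsModularFunction 2 k f)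
    (hf1 : ∀ z, orderAt f z ≠ ⊤) :
    {x : Orbits 2 | orderOnOrbit 2 f x ≠ 0}.Finite := by
  set r := Real.exp (-2 * Real.pi * (1 / 4)) with hr
  have hr1 : r < 1 := by
    rw [hr, Real.exp_lt_one_iff]; linarith [Real.pi_pos]
  have hm : MeromorphicOn (cuspFunction 1 f) (Metric.closedBall 0 r) := fun q hq =>
    hf.meromorphicOn q (Metric.closedBall_subset_ball hr1 hq)
  refine (((MeromorphicOn.divisor (cuspFunction 1 f) (Metric.closedBall 0 r)).finiteSupport
    (isCompact_closedBall 0 r)).image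
      fun q => orbit 2 (ofComplex (Function.Periodic.invQParam 1 q))).subset ?_
  intro x hx
  obtain ⟨z, rfl⟩ : ∃ z, orbit 2 z = x := ⟨_, orbit_out x⟩
  obtain ⟨γ, hγ, him⟩ := exists_smul_im_ge z
  rw [mem_ofPred_eq, hf.orderOnOrbit_orbit, ← hf.orderAt_smul hγ] at hx
  have hq : 𝕢 (γ • z : ℍ) ∈ Metric.closedBall (0 : ℂ) r := mem_closedBall_zero_iff.mpr (norm_qParam_le him)
  refine ⟨𝕢 (γ • z : ℍ), ?_, ?_⟩
  · rw [mem_support, MeromorphicOn.divisor_apply hm hq, ← orderAt_eq hf.periodic]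
    simpa [hf1] using hx
  · change orbit 2 _ = orbit 2 z
    rw [← orbit_smul hγ z]
    apply orbit_eq_of_qParam_eq
    have h0 := Function.Periodic.qParam_ne_zero (h := 1) ((γ • z : ℍ) : ℂ)
    rw [ofComplex_apply_of_im_pos (Function.Periodic.im_invQParam_pos_of_norm_lt_one one_pos
      (by simpa using qParam_mem_ball (γ • z)) h0)]
    exact Function.Periodic.qParam_right_inv one_ne_zero h0

end

/-! ### Weight 0 and the maximum principle -/

section

variable {k : ℤ} {f : ℍ → ℂ}

/-- The normal form of the cusp function of a weight `0` function is invariant. -/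
lemma IsModularFunction.toMeromorphicNFOn_smul (hf : IsModularFunction 2 0 f)
    (hH : AnalyticOnNhd ℂ (toMeromorphicNFOn (cuspFunction 1 f) (Metric.ball 0 1))
      (Metric.ball 0 1)) {γ : SL(2, ℝ)} (hγ : γ ∈ Gamma0Star 2) (z : ℍ) :
    toMeromorphicNFOn (cuspFunction 1 f) (Metric.ball 0 1) (𝕢 (γ • z : ℍ)) =
      toMeromorphicNFOn (cuspFunction 1 f) (Metric.ball 0 1) (𝕢 (z : ℂ)) := by
  set H := toMeromorphicNFOn (cuspFunction 1 f) (Metric.ball 0 1)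
  have key : ∀ w : ℍ, (H ∘ 𝕢) =ᶠ[𝓝[≠] (w : ℂ)] f ∘ ofComplex := by
    intro w
    have h := hf.meromorphicOn.toMeromorphicNFOn_eq_self_on_nhdsNE (qParam_mem_ball w)
    have ht : Tendsto 𝕢 (𝓝[≠] (w : ℂ)) (𝓝[≠] (𝕢 (w : ℂ))) :=
      (hasDerivAt_qParam w).tendsto_nhdsNE
        ((hasDerivAt_qParam w).deriv ▸ deriv_qParam_ne_zero w)
    have := ht.eventually h
    filter_upwards [this] with u hu
    rw [← cuspFunction_comp_qParam hf.periodic]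
    exact hu
  have hA : ∀ w : ℍ, AnalyticAt ℂ (H ∘ 𝕢) (w : ℂ) := fun w =>
    (hH _ (qParam_mem_ball w)).comp (analyticAt_qParam w)
  set M : ℂ → ℂ := fun w => ((γ • ofComplex w : ℍ) : ℂ) with hM
  have hMz : M z = (γ • z : ℍ) := by simp [hM]
  have hMt : Tendsto M (𝓝[≠] (z : ℂ)) (𝓝[≠] (M z)) :=
    (hasStrictDerivAt_smul γ z).hasDerivAt.tendsto_nhdsNE
      ((hasStrictDerivAt_smul γ z).hasDerivAt.deriv ▸ deriv_smul_ne_zero γ z)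
  -- The normal form agrees with `f` only on punctured neighbourhoods, so invariance is first
  -- obtained there and then extended to z by continuity.
  have h1 : (H ∘ 𝕢) ∘ M =ᶠ[𝓝[≠] (z : ℂ)] H ∘ 𝕢 := by
    have := hMt.eventually (hMz ▸ key (γ • z))
    filter_upwards [this, key z] with w hw hw'
    rw [comp_apply, hw, hw']
    simp [hM, hf.transform γ hγ]
  have hc : ContinuousAt ((H ∘ 𝕢) ∘ M) z :=
    ContinuousAt.comp (by rw [hMz]; exact (hA _).continuousAt) (analyticAt_smul γ z).continuousAt
  have := ((hc.eventuallyEq_nhds_iff_eventuallyEq_nhdsNE (hA z).continuousAt).mp h1).eq_of_nhds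
  simpa [hMz] using this

/-- The normal form is holomorphic on the disc and invariant under the group. Every q ≠ 0 is
equivalent to a point of the closed disc of radius e^(−π/2), so the maximum of the modulus there is
a maximum on the whole open disc. -/
lemma IsModularFunction.exists_const (hf : IsModularFunction 2 0 f)
    (h0 : 0 ≤ orderAtInfty f) (h1 : ∀ z, 0 ≤ orderAt f z) :
    ∃ c : ℂ, ∀ q ∈ Metric.ball (0 : ℂ) 1,
      toMeromorphicNFOn (cuspFunction 1 f) (Metric.ball 0 1) q = c := by
  have hmer := hf.meromorphicOn
  have hH : AnalyticOnNhd ℂ (toMeromorphicNFOn (cuspFunction 1 f) (Metric.ball 0 1))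
      (Metric.ball 0 1) := by
    intro q hq
    rw [← (meromorphicNFOn_toMeromorphicNFOn _ _ hq).meromorphicOrderAt_nonneg_iff_analyticAt,
      meromorphicOrderAt_toMeromorphicNFOn hmer hq]
    by_cases hq0 : q = 0
    · rw [hq0]; exact h0
    · obtain ⟨z, rfl⟩ := exists_qParam_eq (by simpa using hq) hq0
      rw [← orderAt_eq hf.periodic]
      exact h1 z
  have hinv := fun γ hγ z => hf.toMeromorphicNFOn_smul hH (γ := γ) hγ z
  set H := toMeromorphicNFOn (cuspFunction 1 f) (Metric.ball 0 1)
  set r := Real.exp (-2 * Real.pi * (1 / 4)) with hr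
  have hr1 : r < 1 := by
    rw [hr, Real.exp_lt_one_iff]; linarith [Real.pi_pos]
  have hr0 : 0 < r := Real.exp_pos _
  obtain ⟨q₀, hq₀, hmax⟩ := (isCompact_closedBall (0 : ℂ) r).exists_isMaxOn
    ⟨0, by simp [hr0.le]⟩ (hH.continuousOn.mono (Metric.closedBall_subset_ball hr1)).norm
  refine ⟨H q₀, fun q hq => ?_⟩
  have hmax' : IsMaxOn (norm ∘ H) (Metric.ball 0 1) q₀ := by
    intro q hq
    by_cases hq0 : q = 0
    · exact hmax (by simp [hq0, hr0.le])
    · obtain ⟨z, rfl⟩ := exists_qParam_eq (by simpa using hq) hq0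
      obtain ⟨γ, hγ, him⟩ := exists_smul_im_ge z
      have := hmax (mem_closedBall_zero_iff.mpr (norm_qParam_le him))
      simp only [mem_ofPred_eq] at this ⊢
      rwa [hinv γ hγ] at this
  exact Complex.eqOn_of_isPreconnected_of_isMaxOn_norm (convex_ball 0 1).isPreconnected
    Metric.isOpen_ball hH.differentiableOn (Metric.closedBall_subset_ball hr1 hq₀) hmax' hq

/-- A positive order at ∞ would make the normal form constant. A constant has the same order
everywhere on the disc, whereas the order at points of ℍ is 0. -/
lemma IsModularFunction.orderAtInfty_nonpos (hf : IsModularFunction 2 0 f)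
    (h1 : ∀ z, orderAt f z = 0) : orderAtInfty f ≤ 0 := by
  classical
  by_contra! h0
  obtain ⟨c, hc⟩ := hf.exists_const h0.le fun z => (h1 z).ge
  have key : ∀ q ∈ Metric.ball (0 : ℂ) 1,
      meromorphicOrderAt (cuspFunction 1 f) q = if c = 0 then ⊤ else 0 := by
    intro q hq
    rw [← meromorphicOrderAt_toMeromorphicNFOn hf.meromorphicOn hq, ← meromorphicOrderAt_const q c]
    apply meromorphicOrderAt_congr
    filter_upwards [nhdsWithin_le_nhds (Metric.isOpen_ball.mem_nhds hq)] with w hw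
    exact hc w hw
  have h2 := h1 I
  rw [orderAt_eq hf.periodic, key _ (qParam_mem_ball _)] at h2
  rw [orderAtInfty, key 0 (by simp), h2] at h0
  exact lt_irrefl _ h0

/-- A modular function of weight `0` without zeros or poles in the upper half-plane has order `0`
at infinity. -/
lemma IsModularFunction.orderAtInfty_eq_zero (hf : IsModularFunction 2 0 f)
    (h1 : ∀ z, orderAt f z = 0) : orderAtInfty f = 0 := by
  refine le_antisymm (hf.orderAtInfty_nonpos h1) ?_
  -- The opposite inequality is the same statement for 1/f.
  have hg : IsModularFunction 2 0 (f ^ (-1 : ℤ)) := by simpa using hf.zpow (-1)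
  have := hg.orderAtInfty_nonpos fun z => by rw [hf.orderAt_zpow, h1, mul_zero]
  rw [hf.orderAtInfty_zpow] at this
  cases h : orderAtInfty f with
  | top => exact le_top
  | coe n =>
    rw [h] at this
    norm_cast at this ⊢
    omega

end

/-! ### Construction of the Hauptmodul from Δ and E₄ -/

section

variable {k : ℤ}

/-- The point `2 z`. -/
def double (z : ℍ) : ℍ := ⟨2 * z, by simpa using z.im_pos⟩

lemma coe_double (z : ℍ) : (double z : ℂ) = 2 * z := rfl

lemma W_smul_eq (z : ℍ) : W 2 • z = ModularGroup.S • double z := by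
  ext
  rw [coe_W_smul, modular_S_smul]
  simp [coe_double, neg_div]

lemma double_W_smul (z : ℍ) : double (W 2 • z) = ModularGroup.S • z := by
  ext
  have := z.ne_zero
  rw [coe_double, coe_W_smul, modular_S_smul]
  change _ = (-(z : ℂ))⁻¹
  field_simp

lemma apply_SL_smul {F : Type*} [FunLike F ℍ ℂ] [ModularFormClass F 𝒮ℒ k] (φ : F)
    (γ : SL(2, ℤ)) (z : ℍ) :
    φ (γ • z) = (((γ 1 0 : ℤ) : ℂ) * z + ((γ 1 1 : ℤ) : ℂ)) ^ k * φ z := by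
  have := SlashInvariantForm.slash_action_eqn' φ (MonoidHom.mem_range.mpr ⟨γ, rfl⟩) z
  rw [show γ • z = Matrix.SpecialLinearGroup.mapGL ℝ γ • z from rfl]
  simpa using this

/-- W₂z = S(2z), so W₂ interchanges φ(z) and φ(2z) up to automorphy factors; `apply_double_W_smul`
is the other half of the exchange. -/
lemma apply_W_smul {F : Type*} [FunLike F ℍ ℂ] [ModularFormClass F 𝒮ℒ k] (φ : F)
    (z : ℍ) : φ (W 2 • z) = (2 * z : ℂ) ^ k * φ (double z) := by
  rw [W_smul_eq, apply_SL_smul]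
  simp [ModularGroup.S, coe_double]

lemma apply_double_W_smul {F : Type*} [FunLike F ℍ ℂ] [ModularFormClass F 𝒮ℒ k] (φ : F)
    (z : ℍ) : φ (double (W 2 • z)) = (z : ℂ) ^ k * φ z := by
  rw [double_W_smul, apply_SL_smul]
  simp [ModularGroup.S]

lemma apply_gamma0_smul {F : Type*} [FunLike F ℍ ℂ] [ModularFormClass F 𝒮ℒ k] (φ : F)
    {γ : SL(2, ℝ)} (hγ : γ ∈ gamma0Real 2) (z : ℍ) :
    φ (γ • z) = (((γ 1 0 : ℝ) : ℂ) * z + ((γ 1 1 : ℝ) : ℂ)) ^ k * φ z := by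
  obtain ⟨δ, -, rfl⟩ := hγ
  rw [map_smul, apply_SL_smul]
  simp

/-- Conjugation by z ↦ 2z carries (a, b; 2c, d) to (a, 2b; c, d), which is again in SL(2, ℤ). -/
lemma apply_double_gamma0_smul {F : Type*} [FunLike F ℍ ℂ] [ModularFormClass F 𝒮ℒ k] (φ : F)
    {γ : SL(2, ℝ)} (hγ : γ ∈ gamma0Real 2) (z : ℍ) :
    φ (double (γ • z)) = (((γ 1 0 : ℝ) : ℂ) * z + ((γ 1 1 : ℝ) : ℂ)) ^ k * φ (double z) := by
  obtain ⟨δ, hδ, rfl⟩ := hγ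
  obtain ⟨c, hc⟩ := (ZMod.intCast_zmod_eq_zero_iff_dvd (δ 1 0) 2).mp
    (CongruenceSubgroup.Gamma0_mem.mp hδ)
  have hdet : δ 0 0 * δ 1 1 - δ 0 1 * δ 1 0 = 1 := by
    rw [← Matrix.det_fin_two, δ.det_coe]
  obtain ⟨ε, h00, h01, h10, h11⟩ : ∃ ε : SL(2, ℤ), ε 0 0 = δ 0 0 ∧ ε 0 1 = 2 * δ 0 1 ∧
      ε 1 0 = c ∧ ε 1 1 = δ 1 1 := by
    refine ⟨⟨!![δ 0 0, 2 * δ 0 1; c, δ 1 1], ?_⟩, rfl, rfl, rfl, rfl⟩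
    rw [Matrix.det_fin_two_of]
    push_cast at hc
    linear_combination hdet + (δ 0 1) * hc
  have hcC : ((δ 1 0 : ℤ) : ℂ) = 2 * c := by rw [hc]; push_cast; ring
  have key : double (Matrix.SpecialLinearGroup.map (Int.castRingHom ℝ) δ • z) = ε • double z := by
    ext
    rw [coe_double, coe_smul, coe_specialLinearGroup_apply]
    simp [h00, h01, h10, h11, coe_double, hcC]
    rw [← mul_div_assoc]
    congr 1 <;> ring
  rw [key, apply_SL_smul, h10, h11]
  simp only [Matrix.SpecialLinearGroup.map_apply_coe, RingHom.mapMatrix_apply, Matrix.map_apply,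
    eq_intCast, Complex.ofReal_intCast, hcC, coe_double]
  ring_nf

lemma differentiableAt_comp_ofComplex {F : Type*} [FunLike F ℍ ℂ] [ModularFormClass F 𝒮ℒ k] (φ : F)
    (z : ℍ) : DifferentiableAt ℂ (φ ∘ ofComplex) z :=
  UpperHalfPlane.mdifferentiableAt_iff.mp (ModularFormClass.holo φ z)

lemma differentiableAt_comp_double {F : Type*} [FunLike F ℍ ℂ] [ModularFormClass F 𝒮ℒ k] (φ : F) (z : ℍ) :
    DifferentiableAt ℂ ((fun w => φ (double w)) ∘ ofComplex) z := by
  have h := (differentiableAt_comp_ofComplex φ (double z)).comp (z : ℂ)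
    (show DifferentiableAt ℂ (fun w : ℂ => 2 * w) z by fun_prop)
  refine h.congr_of_eventuallyEq ?_
  filter_upwards [eventually_im_pos z] with w hw
  have h2 : 0 < (2 * w).im := by simpa using hw
  simp only [comp_apply, ofComplex_apply_of_im_pos hw, ofComplex_apply_of_im_pos h2]
  rfl

lemma cuspFunction_double {F : Type*} [FunLike F ℍ ℂ] [ModularFormClass F 𝒮ℒ k] (φ : F)
    {q : ℂ} (hq : ‖q‖ < 1) (hq0 : q ≠ 0) :
    cuspFunction 1 (fun w => φ (double w)) q = cuspFunction 1 φ (q ^ 2) := by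
  obtain ⟨z, rfl⟩ := exists_qParam_eq hq hq0
  have hp : Periodic (φ ∘ ofComplex) (1 : ℝ) :=
    SlashInvariantFormClass.periodic_comp_ofComplex φ (by simp)
  obtain ⟨m, hm⟩ := Function.Periodic.qParam_left_inv_mod_period one_ne_zero (z : ℂ)
  have him : 0 < (Function.Periodic.invQParam 1 (𝕢 (z : ℂ))).im :=
    Function.Periodic.im_invQParam_pos_of_norm_lt_one one_pos hq hq0
  rw [cuspFunction_of_ne_zero _ hq0, ← eq_cuspFunction _ one_ne_zero hp,
    ofComplex_apply_of_im_pos him]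
  congr 1
  rw [coe_double]
  conv_rhs => rw [← Function.Periodic.qParam_right_inv (h := 1) one_ne_zero hq0]
  simp only [Function.Periodic.qParam]
  rw [← Complex.exp_nat_mul]
  congr 1
  push_cast
  ring

lemma analyticAt_cuspFunction_form {F : Type*} [FunLike F ℍ ℂ] [ModularFormClass F 𝒮ℒ k] (φ : F)
    : AnalyticAt ℂ (cuspFunction 1 φ) 0 :=
  ModularFormClass.analyticAt_cuspFunction_zero φ one_pos (by simp)

lemma analyticAt_cuspFunction_sq {F : Type*} [FunLike F ℍ ℂ] [ModularFormClass F 𝒮ℒ k] (φ : F)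
    : AnalyticAt ℂ (fun q => cuspFunction 1 φ (q ^ 2)) 0 := by
  have := analyticAt_cuspFunction_form φ
  exact AnalyticAt.fun_comp (by simpa using this) (by fun_prop)

lemma eventually_cuspFunction_double {F : Type*} [FunLike F ℍ ℂ] [ModularFormClass F 𝒮ℒ k] (φ : F) :
    cuspFunction 1 (fun w => φ (double w)) =ᶠ[𝓝[≠] 0] fun q => cuspFunction 1 φ (q ^ 2) := by
  filter_upwards [self_mem_nhdsWithin,
    nhdsWithin_le_nhds (Metric.ball_mem_nhds (0 : ℂ) one_pos)] with q hq hq1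
  exact cuspFunction_double φ (by simpa using hq1) hq

lemma denom_W (z : ℍ) : ((W 2 1 0 : ℝ) : ℂ) * z + ((W 2 1 1 : ℝ) : ℂ) = (√2 : ℝ) * z := by
  simp [coe_W]

/-- A transformation law for `Γ₀(2)` and `W₂` holds for `Γ₀*(2)`. -/
lemma transform_of_gamma0_of_W {f : ℍ → ℂ}
    (h0 : ∀ γ ∈ gamma0Real 2, ∀ z : ℍ,
      f (γ • z) = (((γ 1 0 : ℝ) : ℂ) * (z : ℂ) + ((γ 1 1 : ℝ) : ℂ)) ^ k * f z)
    (hW : ∀ z : ℍ, f (W 2 • z) = (((√2 : ℝ) : ℂ) * z) ^ k * f z) :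
    ∀ γ ∈ Gamma0Star 2, ∀ z : ℍ,
      f (γ • z) = (((γ 1 0 : ℝ) : ℂ) * (z : ℂ) + ((γ 1 1 : ℝ) : ℂ)) ^ k * f z := by
  rintro γ (hγ | ⟨h, hh, rfl⟩) z
  · exact h0 γ hγ z
  · rw [mul_smul, h0 h hh, hW, ← mul_assoc, ← mul_zpow, coe_W_smul]
    congr 2
    have h2 : ((√2 : ℝ) : ℂ) ^ 2 = 2 := by exact_mod_cast Real.sq_sqrt (by norm_num : (0 : ℝ) ≤ 2)
    have hs : ((√2 : ℝ) : ℂ) ≠ 0 := by intro h; simp [h] at h2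
    have hz := z.ne_zero
    rw [Matrix.SpecialLinearGroup.coe_mul, coe_W]
    simp [Matrix.mul_apply, Fin.sum_univ_two]
    field_simp
    rw [h2]
    ring

lemma sqrt_two_mul_pow (w : ℂ) (n : ℕ) : (((√2 : ℝ) : ℂ) * w) ^ (2 * n) = 2 ^ n * w ^ (2 * n) := by
  have h2 : ((√2 : ℝ) : ℂ) ^ 2 = 2 := by exact_mod_cast Real.sq_sqrt (by norm_num : (0 : ℝ) ≤ 2)
  rw [mul_pow, pow_mul, h2]

lemma analyticAt_of_differentiable {f : ℍ → ℂ}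
    (hf : ∀ z : ℍ, DifferentiableAt ℂ (f ∘ ofComplex) z) (z : ℍ) :
    AnalyticAt ℂ (f ∘ ofComplex) (z : ℂ) := by
  rw [Complex.analyticAt_iff_eventually_differentiableAt]
  filter_upwards [eventually_im_pos z] with w hw
  exact hf ⟨w, hw⟩

/-- The form `Δ(z) Δ(2z)` of weight `24`. -/
def deltaForm (z : ℍ) : ℂ := CuspForm.discriminant z * CuspForm.discriminant (double z)

/-- A form of weight `12` with a simple zero at infinity. -/
def eisForm (z : ℍ) : ℂ :=
  (ModularForm.E₄ z - ModularForm.E₄ (double z)) *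
    (16 * ModularForm.E₄ (double z) - ModularForm.E₄ z) *
    (ModularForm.E₄ z + 4 * ModularForm.E₄ (double z))

lemma deltaForm_ne_zero (z : ℍ) : deltaForm z ≠ 0 :=
  mul_ne_zero (ModularForm.discriminant_ne_zero z) (ModularForm.discriminant_ne_zero _)

lemma analyticAt_deltaForm (z : ℍ) : AnalyticAt ℂ (deltaForm ∘ ofComplex) z :=
  analyticAt_of_differentiable (f := deltaForm) (fun w =>
    (differentiableAt_comp_ofComplex CuspForm.discriminant w).mul
      (differentiableAt_comp_double CuspForm.discriminant w)) z

lemma analyticAt_eisForm (z : ℍ) : AnalyticAt ℂ (eisForm ∘ ofComplex) z := by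
  refine analyticAt_of_differentiable (fun w => ?_) z
  have h1 := differentiableAt_comp_ofComplex ModularForm.E₄ w
  have h2 := differentiableAt_comp_double ModularForm.E₄ w
  exact ((h1.sub h2).mul ((h2.const_mul 16).sub h1)).mul (h1.add (h2.const_mul 4))

lemma cuspFunction_deltaForm : cuspFunction 1 deltaForm =ᶠ[𝓝[≠] 0]
    fun q => cuspFunction 1 CuspForm.discriminant q * cuspFunction 1 CuspForm.discriminant (q ^ 2) := by
  filter_upwards [self_mem_nhdsWithin, eventually_cuspFunction_double CuspForm.discriminant]
    with q hq h
  rw [← h]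
  simp [cuspFunction_of_ne_zero _ hq, deltaForm]

lemma cuspFunction_eisForm : cuspFunction 1 eisForm =ᶠ[𝓝[≠] 0]
    fun q => (cuspFunction 1 ModularForm.E₄ q - cuspFunction 1 ModularForm.E₄ (q ^ 2)) *
      (16 * cuspFunction 1 ModularForm.E₄ (q ^ 2) - cuspFunction 1 ModularForm.E₄ q) *
      (cuspFunction 1 ModularForm.E₄ q + 4 * cuspFunction 1 ModularForm.E₄ (q ^ 2)) := by
  filter_upwards [self_mem_nhdsWithin, eventually_cuspFunction_double ModularForm.E₄]
    with q hq h
  rw [← h]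
  simp [cuspFunction_of_ne_zero _ hq, eisForm]

lemma isModularFunction_deltaForm : IsModularFunction 2 24 deltaForm where
  meromorphicAt z := (analyticAt_deltaForm z).meromorphicAt
  transform := by
    refine transform_of_gamma0_of_W (fun γ hγ z => ?_) (fun z => ?_)
    · have hd := denom_ne_zero' γ z
      rw [deltaForm, apply_gamma0_smul _ hγ, apply_double_gamma0_smul _ hγ, deltaForm,
        show (24 : ℤ) = 12 + 12 by norm_num, zpow_add₀ hd]
      ring
    · rw [deltaForm, apply_W_smul, apply_double_W_smul, deltaForm]
      have := sqrt_two_mul_pow z 12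
      norm_num at this
      norm_cast at this ⊢
      rw [this]
      ring
  meromorphicAt_infty := by
    have h1 := analyticAt_cuspFunction_form CuspForm.discriminant
    have h2 := analyticAt_cuspFunction_sq CuspForm.discriminant
    exact (h1.mul h2).meromorphicAt.congr cuspFunction_deltaForm.symm

/-- Under W₂ the first two factors are exchanged, with total factor 16z⁸, and the third is
multiplied by 4z⁴; together this is (√2 z)¹². The third factor raises the weight to 12, so that the
square matches the weight of `deltaForm`. -/
lemma isModularFunction_eisForm : IsModularFunction 2 12 eisForm where
  meromorphicAt z := (analyticAt_eisForm z).meromorphicAt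
  transform := by
    refine transform_of_gamma0_of_W (fun γ hγ z => ?_) (fun z => ?_)
    · have hd := denom_ne_zero' γ z
      rw [eisForm, apply_gamma0_smul _ hγ, apply_double_gamma0_smul _ hγ, eisForm,
        show (12 : ℤ) = 4 + 4 + 4 by norm_num, zpow_add₀ hd, zpow_add₀ hd]
      ring
    · rw [eisForm, apply_W_smul, apply_double_W_smul, eisForm]
      have := sqrt_two_mul_pow z 6
      norm_num at this
      norm_cast at this ⊢
      rw [this]
      ring
  meromorphicAt_infty := by
    have h1 := analyticAt_cuspFunction_form ModularForm.E₄
    have h2 := analyticAt_cuspFunction_sq ModularForm.E₄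
    refine AnalyticAt.meromorphicAt ?_ |>.congr cuspFunction_eisForm.symm
    fun_prop

lemma meromorphicOrderAt_eq_one {f : ℂ → ℂ} {z : ℂ} (hf : AnalyticAt ℂ f z) (h0 : f z = 0)
    (h1 : deriv f z ≠ 0) : meromorphicOrderAt f z = 1 := by
  have := hf.analyticOrderAt_sub_eq_one_of_deriv_ne_zero h1
  simp only [h0, sub_zero] at this
  rw [hf.meromorphicOrderAt_eq, this]
  rfl

lemma meromorphicOrderAt_eq_zero {f : ℂ → ℂ} {z : ℂ} (hf : AnalyticAt ℂ f z) (h0 : f z ≠ 0) :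
    meromorphicOrderAt f z = 0 := by
  rw [hf.meromorphicOrderAt_eq, hf.analyticOrderAt_eq_zero.mpr h0]
  rfl

lemma meromorphicOrderAt_comp_sq {f : ℂ → ℂ} (hf : AnalyticAt ℂ f 0)
    (h : meromorphicOrderAt f 0 = 1) : meromorphicOrderAt (fun q => f (q ^ 2)) 0 = 2 := by
  have h2 : analyticOrderAt (fun q : ℂ => q ^ 2 - 0 ^ 2) 0 = 2 := by
    have := analyticOrderAt_pow (analyticAt_id (𝕜 := ℂ) (z := 0)) 2
    rw [analyticOrderAt_id] at this
    simpa [Pi.pow_def] using this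
  have h0 : meromorphicOrderAt f ((fun q : ℂ => q ^ 2) 0) = 1 := by simpa using h
  have := MeromorphicAt.meromorphicOrderAt_comp (f := f) (g := fun q : ℂ => q ^ 2) (x := 0)
    (by simpa using hf.meromorphicAt) (by fun_prop)
    (by rw [eventuallyConst_iff_analyticOrderAt_sub_eq_top, h2]; simp)
  rw [h2, h0] at this
  simpa [comp_def] using this

lemma orderAtInfty_deltaForm : orderAtInfty deltaForm = 3 := by
  have h1 := analyticAt_cuspFunction_form CuspForm.discriminant
  have h2 := analyticAt_cuspFunction_sq CuspForm.discriminant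
  have hd : meromorphicOrderAt (cuspFunction 1 CuspForm.discriminant) 0 = 1 := by
    refine meromorphicOrderAt_eq_one h1 ?_ ?_
    · exact ModularForm.discriminant_isZeroAtImInfty.cuspFunction_apply_zero one_pos
    · have := ModularForm.discriminant_qExpansion_coeff_one
      rw [qExpansion_coeff] at this
      simp at this
      simp [this]
  rw [orderAtInfty, meromorphicOrderAt_congr cuspFunction_deltaForm]
  refine (meromorphicOrderAt_mul h1.meromorphicAt h2.meromorphicAt).trans ?_
  rw [hd, meromorphicOrderAt_comp_sq h1 hd]
  rfl

/-- As E₄ = 1 + 240q + ⋯, the first factor starts with 240q, while the others take the values 15 and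
5 at q = 0. -/
lemma orderAtInfty_eisForm : orderAtInfty eisForm = 1 := by
  have h1 := analyticAt_cuspFunction_form ModularForm.E₄
  have h2 := analyticAt_cuspFunction_sq ModularForm.E₄
  have e0 : cuspFunction 1 ModularForm.E₄ 0 = 1 := by
    have := EisensteinSeries.E_qExpansion_coeff_zero (k := 4) (by norm_num) ⟨2, rfl⟩
    rw [qExpansion_coeff] at this
    simpa using this
  have e1 : deriv (cuspFunction 1 ModularForm.E₄) 0 = 240 := by
    have := ModularForm.E₄_qExpansion_coeff_one
    rw [qExpansion_coeff] at this
    simpa using this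
  rw [orderAtInfty, meromorphicOrderAt_congr cuspFunction_eisForm]
  have a1 := (h1.sub h2)
  have a2 : AnalyticAt ℂ (fun q => 16 * cuspFunction 1 ModularForm.E₄ (q ^ 2) -
      cuspFunction 1 ModularForm.E₄ q) 0 := by fun_prop
  have a3 : AnalyticAt ℂ (fun q => cuspFunction 1 ModularForm.E₄ q +
      4 * cuspFunction 1 ModularForm.E₄ (q ^ 2)) 0 := by fun_prop
  have hd : deriv (fun q => cuspFunction 1 ModularForm.E₄ (q ^ 2)) 0 = 0 := by
    have h : HasDerivAt (fun q : ℂ => cuspFunction 1 ModularForm.E₄ (q ^ 2)) _ 0 :=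
      HasDerivAt.comp 0 (h₂ := cuspFunction 1 ModularForm.E₄) (h := fun q : ℂ => q ^ 2)
      (by rw [zero_pow two_ne_zero]; exact h1.differentiableAt.hasDerivAt) (hasDerivAt_pow 2 (0 : ℂ))
    simpa using h.deriv
  refine (meromorphicOrderAt_mul (a1.mul a2).meromorphicAt a3.meromorphicAt).trans ?_
  rw [meromorphicOrderAt_mul a1.meromorphicAt a2.meromorphicAt,
    meromorphicOrderAt_eq_one a1 (by simp) ?_,
    meromorphicOrderAt_eq_zero a2 ?_, meromorphicOrderAt_eq_zero a3 ?_]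
  · simp
  · simp [e0]; norm_num
  · simp [e0]; norm_num
  · rw [deriv_sub h1.differentiableAt h2.differentiableAt, e1, hd]
    norm_num

/-- A Hauptmodul of `Γ₀*(2)`. -/
def hauptmodul : ℍ → ℂ := eisForm ^ (2 : ℤ) * deltaForm ^ (-1 : ℤ)

lemma isModularFunction_hauptmodul : IsModularFunction 2 0 hauptmodul := by
  have := (isModularFunction_eisForm.zpow 2).mul (isModularFunction_deltaForm.zpow (-1))
  rwa [show (12 * 2 + 24 * (-1) : ℤ) = 0 by norm_num] at this

lemma analyticAt_hauptmodul (z : ℍ) : AnalyticAt ℂ (hauptmodul ∘ ofComplex) z := by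
  refine ((analyticAt_eisForm z).zpow_nonneg (by norm_num)).mul ((analyticAt_deltaForm z).zpow ?_)
  simpa using deltaForm_ne_zero z

lemma orderAtInfty_hauptmodul : orderAtInfty hauptmodul = (-1 : ℤ) := by
  rw [hauptmodul, (isModularFunction_eisForm.zpow 2).orderAtInfty_mul
    (isModularFunction_deltaForm.zpow (-1)), isModularFunction_eisForm.orderAtInfty_zpow,
    isModularFunction_deltaForm.orderAtInfty_zpow, orderAtInfty_eisForm, orderAtInfty_deltaForm]
  rfl

lemma orderAt_deltaForm (z : ℍ) : orderAt deltaForm z = 0 :=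
  meromorphicOrderAt_eq_zero (analyticAt_deltaForm z) (by simpa using deltaForm_ne_zero z)

end

/-! ### The Hauptmodul separates orbits -/

section

lemma exists_injOn_of_hasStrictDerivAt {f : ℂ → ℂ} {f' a : ℂ} (hf : HasStrictDerivAt f f' a)
    (h : f' ≠ 0) : ∃ U ∈ 𝓝 a, InjOn f U := by
  have hF := hf.hasStrictFDerivAt_equiv h
  exact ⟨_, (hF.toOpenPartialHomeomorph f).open_source.mem_nhds hF.mem_toOpenPartialHomeomorph_source,
    (hF.toOpenPartialHomeomorph f).injOn⟩

lemma hauptmodul_smul {γ : SL(2, ℝ)} (hγ : γ ∈ Gamma0Star 2) (z : ℍ) :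
    hauptmodul (γ • z) = hauptmodul z := by
  simpa using isModularFunction_hauptmodul.transform γ hγ z

lemma continuous_hauptmodul : Continuous hauptmodul := by
  rw [continuous_iff_continuousAt]
  intro z
  have := (analyticAt_hauptmodul z).continuousAt.comp continuous_coe.continuousAt
  convert! this using 1
  ext w
  simp

lemma cuspFunction_hauptmodul (z : ℍ) : cuspFunction 1 hauptmodul (𝕢 (z : ℂ)) = hauptmodul z :=
  eq_cuspFunction z one_ne_zero isModularFunction_hauptmodul.periodic

lemma tendsto_cuspFunction_hauptmodul :
    Tendsto (cuspFunction 1 hauptmodul) (𝓝[≠] 0) (Bornology.cobounded ℂ) :=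
  tendsto_cobounded_of_meromorphicOrderAt_neg (by
    rw [← orderAtInfty, orderAtInfty_hauptmodul]; exact_mod_cast neg_one_lt_zero)

lemma tendsto_hauptmodul : Tendsto hauptmodul atImInfty (Bornology.cobounded ℂ) := by
  have h : Tendsto (fun z : ℍ => 𝕢 (z : ℂ)) atImInfty (𝓝[≠] 0) :=
    (Function.Periodic.qParam_tendsto one_pos).comp tendsto_coe_atImInfty
  exact (tendsto_cuspFunction_hauptmodul.comp h).congr cuspFunction_hauptmodul

lemma exists_im_le (R : ℝ) : ∃ Y : ℝ, ∀ z : ℍ, ‖hauptmodul z‖ ≤ R → z.im ≤ Y := by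
  have h := tendsto_norm_cobounded_atTop.comp tendsto_hauptmodul
  have h1 := h.eventually_gt_atTop R
  obtain ⟨A, hA⟩ := (atImInfty_mem _).mp h1
  refine ⟨A, fun z hz => ?_⟩
  by_contra! hlt
  exact absurd hz (not_le.mpr (hA z hlt.le))

/-- The pole at q = 0 is simple, so the reciprocal q/g(q) has nonzero derivative there and is
locally injective. -/
lemma exists_injOn_cuspFunction_hauptmodul : ∃ ε > 0, ∀ q q' : ℂ, q ≠ 0 → q' ≠ 0 → ‖q‖ < ε →
    ‖q'‖ < ε → cuspFunction 1 hauptmodul q = cuspFunction 1 hauptmodul q' → q = q' := by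
  have hm := isModularFunction_hauptmodul.meromorphicAt_infty
  have ho := orderAtInfty_hauptmodul
  rw [orderAtInfty, meromorphicOrderAt_eq_int_iff hm] at ho
  obtain ⟨g, hg, hg0, h⟩ := ho
  have hd : HasStrictDerivAt (fun q => q * (g q)⁻¹) ((g 0)⁻¹) 0 := by
    have := (hasStrictDerivAt_id (0 : ℂ)).mul (hg.inv hg0).hasStrictDerivAt
    simp only [id, one_mul, zero_mul, add_zero, Pi.inv_apply] at this
    exact this
  obtain ⟨U, hU, hinj⟩ := exists_injOn_of_hasStrictDerivAt hd (inv_ne_zero hg0)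
  obtain ⟨ε, hε, hball⟩ := Metric.eventually_nhds_iff.mp
    ((eventually_nhdsWithin_iff.mp h).and (eventually_mem_set.mpr hU))
  refine ⟨ε, hε, fun q q' hq hq' hqε hqε' heq => ?_⟩
  obtain ⟨h1, h2⟩ := hball (y := q) (by simpa using hqε)
  obtain ⟨h1', h2'⟩ := hball (y := q') (by simpa using hqε')
  apply hinj h2 h2'
  rw [h1 hq, h1' hq'] at heq
  have := congrArg (·⁻¹) heq
  simpa [mul_comm] using this

/-- On the compact annulus ε ≤ |q| ≤ e^(−π/2) the Hauptmodul is bounded, so large values force q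
close to 0. -/
lemma exists_norm_qParam_lt {ε : ℝ} (hε : 0 < ε) : ∃ R : ℝ, ∀ z : ℍ, 1 / 4 ≤ z.im →
    R < ‖hauptmodul z‖ → ‖𝕢 (z : ℂ)‖ < ε := by
  set r := Real.exp (-2 * Real.pi * (1 / 4)) with hr
  have hr1 : r < 1 := by
    rw [hr, Real.exp_lt_one_iff]; linarith [Real.pi_pos]
  have hc : IsCompact (Metric.closedBall (0 : ℂ) r \ Metric.ball 0 ε) :=
    (isCompact_closedBall 0 r).diff Metric.isOpen_ball
  have hcont : ContinuousOn (cuspFunction 1 hauptmodul)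
      (Metric.closedBall (0 : ℂ) r \ Metric.ball 0 ε) := by
    rintro q ⟨hq, hq'⟩
    have hq0 : q ≠ 0 := by rintro rfl; simp [hε] at hq'
    have hq1 : ‖q‖ < 1 := (mem_closedBall_zero_iff.mp hq).trans_lt hr1
    obtain ⟨z, rfl⟩ := exists_qParam_eq hq1 hq0
    exact (isModularFunction_hauptmodul.periodic.differentiableAt_cuspFunction one_ne_zero
      (analyticAt_hauptmodul z).differentiableAt).continuousAt.continuousWithinAt
  obtain ⟨R, hR⟩ := hc.exists_bound_of_continuousOn hcont
  refine ⟨R, fun z hz hlt => ?_⟩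
  by_contra! hge
  have := hR (𝕢 (z : ℂ)) ⟨mem_closedBall_zero_iff.mpr (norm_qParam_le hz), by simpa using hge⟩
  rw [cuspFunction_hauptmodul] at this
  linarith

/-- Near infinity the Hauptmodul separates orbits. -/
lemma exists_orbit_eq_of_lt_norm : ∃ R : ℝ, ∀ z w : ℍ, R < ‖hauptmodul z‖ →
    hauptmodul z = hauptmodul w → orbit 2 z = orbit 2 w := by
  obtain ⟨ε, hε, hinj⟩ := exists_injOn_cuspFunction_hauptmodul
  obtain ⟨R, hR⟩ := exists_norm_qParam_lt hε
  refine ⟨R, fun z w hz hzw => ?_⟩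
  obtain ⟨γ, hγ, h⟩ := exists_smul_im_ge z
  obtain ⟨δ, hδ, h'⟩ := exists_smul_im_ge w
  rw [← orbit_smul hγ z, ← orbit_smul hδ w]
  apply orbit_eq_of_qParam_eq
  refine hinj _ _ (Function.Periodic.qParam_ne_zero _) (Function.Periodic.qParam_ne_zero _)
    (hR _ h ?_) (hR _ h' ?_) ?_
  · rwa [hauptmodul_smul hγ]
  · rwa [hauptmodul_smul hδ, ← hzw]
  · rw [cuspFunction_hauptmodul, cuspFunction_hauptmodul, hauptmodul_smul hγ, hauptmodul_smul hδ,
      hzw]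

lemma isCompact_strip (Y : ℝ) :
    IsCompact {z : ℍ | |z.re| ≤ 1 / 2 ∧ 1 / 4 ≤ z.im ∧ z.im ≤ Y} := by
  rw [isEmbedding_coe.isCompact_iff]
  have : ((↑) : ℍ → ℂ) '' {z : ℍ | |z.re| ≤ 1 / 2 ∧ 1 / 4 ≤ z.im ∧ z.im ≤ Y} =
      Icc (-(1 / 2)) (1 / 2) ×ℂ Icc (1 / 4) Y := by
    ext w
    simp only [mem_image, mem_ofPred_eq, Complex.mem_reProdIm, mem_Icc, abs_le]
    constructor
    · rintro ⟨z, h, rfl⟩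
      exact h
    · rintro ⟨h1, h2⟩
      exact ⟨⟨w, by linarith [h2.1]⟩, ⟨h1, h2⟩, rfl⟩
  rw [this]
  exact isCompact_Icc.reProdIm isCompact_Icc

/-- Properness of the Hauptmodul modulo the group: the pole at ∞ bounds Im z from above, and
reduction to the strip does the rest. -/
lemma exists_smul_mem_compact (R : ℝ) : ∃ K : Set ℍ, IsCompact K ∧ ∀ z, ‖hauptmodul z‖ ≤ R →
    ∃ γ ∈ Gamma0Star 2, γ • z ∈ K := by
  obtain ⟨Y, hY⟩ := exists_im_le R
  refine ⟨_, isCompact_strip Y, fun z hz => ?_⟩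
  obtain ⟨γ, hγ, h1, h2⟩ := exists_smul_mem_strip z
  exact ⟨γ, hγ, h2, h1, hY _ (by rwa [hauptmodul_smul hγ])⟩

lemma analyticOnNhd_hauptmodul :
    AnalyticOnNhd ℂ (hauptmodul ∘ ofComplex) upperHalfPlaneSet :=
  fun z hz => analyticAt_hauptmodul ⟨z, hz⟩

lemma isPreconnected_upperHalfPlaneSet : IsPreconnected upperHalfPlaneSet :=
  (convex_halfSpace_im_gt 0).isPreconnected

lemma hauptmodul_not_const : ¬ ∃ c, ∀ z, hauptmodul z = c := by
  rintro ⟨c, hc⟩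
  obtain ⟨Y, hY⟩ := exists_im_le ‖c‖
  have := hY ⟨Complex.I * (max Y 0 + 1 : ℝ), by simp; positivity⟩ (by rw [hc])
  rw [← coe_im] at this
  simp at this
  linarith [le_max_left Y 0]

lemma isOpenMap_hauptmodul : IsOpenMap hauptmodul := by
  intro U hU
  rcases analyticOnNhd_hauptmodul.is_constant_or_isOpen isPreconnected_upperHalfPlaneSet with
    ⟨c, hc⟩ | h
  · exact absurd ⟨c, fun z => by simpa using hc z z.im_pos⟩ hauptmodul_not_const
  · have := h (((↑) : ℍ → ℂ) '' U) (by rintro _ ⟨z, -, rfl⟩; exact z.im_pos)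
      (isOpenEmbedding_coe.isOpenMap U hU)
    rw [image_image] at this
    simpa using this

/-- The critical values of the Hauptmodul. -/
def criticalValues : Set ℂ :=
  {w | ∃ z : ℍ, deriv (hauptmodul ∘ ofComplex) z = 0 ∧ hauptmodul z = w}

lemma exists_deriv_hauptmodul_ne_zero :
    ∃ z : ℍ, deriv (hauptmodul ∘ ofComplex) (z : ℂ) ≠ 0 := by
  by_contra! H
  apply hauptmodul_not_const
  refine ⟨hauptmodul I, fun z => ?_⟩
  have := isOpen_upperHalfPlaneSet.is_const_of_deriv_eq_zero isPreconnected_upperHalfPlaneSet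
    (fun w hw => (analyticOnNhd_hauptmodul w hw).differentiableAt.differentiableWithinAt)
    (fun w hw => H ⟨w, hw⟩) z.im_pos I.im_pos
  simpa only [comp_apply, ofComplex_apply] using this

/-- The zeros of the derivative, which is analytic and not identically 0, form a discrete and hence
countable set. Countability makes the complement of the critical values connected and dense in ℂ. -/
lemma countable_criticalValues : criticalValues.Countable := by
  have hc : ({z | deriv (hauptmodul ∘ ofComplex) z = 0} ∩ upperHalfPlaneSet).Countable := by
    apply (HereditarilyLindelofSpace.isLindelof _).countable_of_isDiscrete
      (isDiscrete_of_codiscreteWithin _)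
    obtain ⟨z, hz⟩ := exists_deriv_hauptmodul_ne_zero
    exact analyticOnNhd_hauptmodul.deriv.preimage_zero_mem_codiscreteWithin hz z.im_pos
      ⟨⟨z, z.im_pos⟩, isPreconnected_upperHalfPlaneSet⟩
  refine (hc.image (hauptmodul ∘ ofComplex)).mono ?_
  rintro w ⟨z, hz, rfl⟩
  exact ⟨z, ⟨hz, z.im_pos⟩, by simp⟩

/-- The values taken by the Hauptmodul on more than one orbit. -/
def multipleValues : Set ℂ :=
  {w | ∃ z z' : ℍ, hauptmodul z = w ∧ hauptmodul z' = w ∧ orbit 2 z ≠ orbit 2 z'}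

/-- Two distinct orbits have disjoint neighbourhoods in the Hausdorff quotient, and the Hauptmodul,
being open, maps both onto neighbourhoods of the common value. -/
lemma isOpen_multipleValues : IsOpen multipleValues := by
  rw [isOpen_iff_mem_nhds]
  rintro w ⟨z, z', hz, hz', hne⟩
  let π : ℍ → Quotient (MulAction.orbitRel (Gamma0Star 2) ℍ) := Quotient.mk _
  have hπ : Continuous π := continuous_quot_mk
  have hne' : π z ≠ π z' := hne
  obtain ⟨U, V, hU, hV, hzU, hzV, hUV⟩ := t2_separation hne'
  have h1 : hauptmodul '' (π ⁻¹' U) ∈ 𝓝 w :=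
    (isOpenMap_hauptmodul _ (hU.preimage hπ)).mem_nhds ⟨z, hzU, hz⟩
  have h2 : hauptmodul '' (π ⁻¹' V) ∈ 𝓝 w :=
    (isOpenMap_hauptmodul _ (hV.preimage hπ)).mem_nhds ⟨z', hzV, hz'⟩
  filter_upwards [h1, h2]
  rintro v ⟨y, hy, hyv⟩ ⟨y', hy', hyv'⟩
  refine ⟨y, y', hyv, hyv', fun h => ?_⟩
  have h' : π y = π y' := h
  exact disjoint_left.mp hUV hy (by rw [mem_preimage, ← h'] at hy'; exact hy')

/-- By properness, pairs of inequivalent points with equal values subconverge. If the limits were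
equivalent, moving one onto the other would give two inequivalent points with the same value
arbitrarily near a noncritical point, against local injectivity. -/
lemma mem_multipleValues_of_mem_closure {w : ℂ} (hw : w ∈ closure multipleValues)
    (hwV : w ∉ criticalValues) : w ∈ multipleValues := by
  by_contra hB
  obtain ⟨u, hu, hlim⟩ := mem_closure_iff_seq_limit.mp hw
  obtain ⟨R, hR⟩ := (Metric.isBounded_range_of_tendsto u hlim).exists_norm_le
  obtain ⟨K, hK, hKR⟩ := exists_smul_mem_compact R
  have key : ∀ n, ∃ a : ℍ × ℍ, a ∈ K ×ˢ K ∧ hauptmodul a.1 = u n ∧ hauptmodul a.2 = u n ∧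
      orbit 2 a.1 ≠ orbit 2 a.2 := by
    intro n
    obtain ⟨z, z', hz, hz', hne⟩ := hu n
    obtain ⟨γ, hγ, h⟩ := hKR z (by rw [hz]; exact hR _ ⟨n, rfl⟩)
    obtain ⟨δ, hδ, h'⟩ := hKR z' (by rw [hz']; exact hR _ ⟨n, rfl⟩)
    exact ⟨(γ • z, δ • z'), ⟨h, h'⟩, by rw [hauptmodul_smul hγ, hz],
      by rw [hauptmodul_smul hδ, hz'], by rwa [orbit_smul hγ, orbit_smul hδ]⟩
  choose a haK ha1 ha2 hane using key
  obtain ⟨⟨p, p'⟩, -, φ, hφ, hlim'⟩ := (hK.prod hK).tendsto_subseq haK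
  have hp : Tendsto (fun n => (a (φ n)).1) atTop (𝓝 p) := (continuous_fst.tendsto _).comp hlim'
  have hp' : Tendsto (fun n => (a (φ n)).2) atTop (𝓝 p') := (continuous_snd.tendsto _).comp hlim'
  have hlimφ : Tendsto (fun n => u (φ n)) atTop (𝓝 w) := hlim.comp hφ.tendsto_atTop
  have hpw : hauptmodul p = w :=
    tendsto_nhds_unique (((continuous_hauptmodul.tendsto p).comp hp).congr fun n => ha1 _) hlimφ
  have hpw' : hauptmodul p' = w :=
    tendsto_nhds_unique (((continuous_hauptmodul.tendsto p').comp hp').congr fun n => ha2 _) hlimφ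
  have horb : orbit 2 p = orbit 2 p' := by
    by_contra hne
    exact hB ⟨p, p', hpw, hpw', hne⟩
  obtain ⟨γ, hγ, rfl⟩ := orbit_eq_iff.mp horb
  have hγ' : Tendsto (fun n => γ • (a (φ n)).2) atTop (𝓝 (γ • p')) :=
    ((continuous_const_smul γ).tendsto p').comp hp'
  have hder : deriv (hauptmodul ∘ ofComplex) ((γ • p' : ℍ) : ℂ) ≠ 0 := fun h => hwV ⟨_, h, hpw⟩
  obtain ⟨U, hU, hinj⟩ := exists_injOn_of_hasStrictDerivAt
    (analyticAt_hauptmodul (γ • p')).hasStrictDerivAt hder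
  have hU' := continuous_coe.continuousAt.preimage_mem_nhds hU
  obtain ⟨n, h1, h2⟩ := ((hp.eventually hU').and (hγ'.eventually hU')).exists
  have heq := hinj h1 h2 (by
    simp only [comp_apply, ofComplex_apply]
    rw [ha1, hauptmodul_smul hγ, ha2])
  apply hane (φ n)
  rw [UpperHalfPlane.ext heq, orbit_smul hγ]

/-- The Hauptmodul separates orbits. -/
theorem orbit_eq_of_hauptmodul_eq {z w : ℍ} (h : hauptmodul z = hauptmodul w) :
    orbit 2 z = orbit 2 w := by
  by_contra hne
  have hV := countable_criticalValues
  have hconn : IsPreconnected criticalValuesᶜ :=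
    (hV.isConnected_compl_of_one_lt_rank (by simp [Complex.rank_real_complex])).isPreconnected
  have hdense : Dense criticalValuesᶜ := hV.dense_compl ℝ
  have hmeet : (criticalValuesᶜ ∩ multipleValues).Nonempty := by
    obtain ⟨v, hv, hv'⟩ := hdense.inter_open_nonempty _ isOpen_multipleValues
      ⟨_, z, w, rfl, h.symm, hne⟩
    exact ⟨v, hv', hv⟩
  -- Within the connected set of noncritical values, the multiple values are open, closed and
  -- nonempty, hence everything. This fails for noncritical values of large modulus, which are
  -- attained on at most one orbit.
  have hsub : criticalValuesᶜ ⊆ multipleValues :=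
    hconn.subset_of_closure_inter_subset isOpen_multipleValues hmeet
      fun v hv => mem_multipleValues_of_mem_closure hv.1 hv.2
  obtain ⟨R, hR⟩ := exists_orbit_eq_of_lt_norm
  have hopen : IsOpen {v : ℂ | R < ‖v‖} := isOpen_lt continuous_const continuous_norm
  obtain ⟨v, hv, hv'⟩ := hdense.inter_open_nonempty _ hopen
    ⟨((|R| + 1 : ℝ) : ℂ), by
      rw [mem_ofPred_eq, Complex.norm_real, Real.norm_eq_abs]
      have := le_abs_self R
      have := le_abs_self (|R| + 1)
      linarith⟩
  obtain ⟨y, y', hy, hy', hne'⟩ := hsub hv'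
  exact hne' (hR y y' (by rw [hy]; exact hv) (by rw [hy, hy']))

end

/-! ### The valence formula with ramification indices, and their computation -/

section

variable {k : ℤ} {f : ℍ → ℂ}

/-- The Hauptmodul minus its value on an orbit. -/
def shifted (x : Orbits 2) (w : ℍ) : ℂ := hauptmodul w - hauptmodul (Quotient.out x)

lemma hauptmodul_out (z : ℍ) : hauptmodul (Quotient.out (orbit 2 z)) = hauptmodul z := by
  obtain ⟨γ, hγ, h⟩ := orbit_eq_iff.mp (orbit_out (orbit 2 z))
  rw [← h, hauptmodul_smul hγ]

lemma analyticAt_shifted (x : Orbits 2) (z : ℍ) : AnalyticAt ℂ (shifted x ∘ ofComplex) z :=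
  (analyticAt_hauptmodul z).sub analyticAt_const

lemma cuspFunction_shifted (x : Orbits 2) : cuspFunction 1 (shifted x) =ᶠ[𝓝[≠] 0]
    cuspFunction 1 hauptmodul + fun _ => -hauptmodul (Quotient.out x) := by
  filter_upwards [self_mem_nhdsWithin] with q hq
  simp [cuspFunction_of_ne_zero _ hq, shifted, sub_eq_add_neg]

lemma isModularFunction_shifted (x : Orbits 2) : IsModularFunction 2 0 (shifted x) where
  meromorphicAt z := (analyticAt_shifted x z).meromorphicAt
  transform γ hγ z := by simp [shifted, hauptmodul_smul hγ]
  meromorphicAt_infty := (isModularFunction_hauptmodul.meromorphicAt_infty.add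
    (MeromorphicAt.const _ _)).congr (cuspFunction_shifted x).symm

lemma orderAtInfty_shifted (x : Orbits 2) : orderAtInfty (shifted x) = (-1 : ℤ) := by
  classical
  rw [orderAtInfty, meromorphicOrderAt_congr (cuspFunction_shifted x),
    meromorphicOrderAt_add_eq_left_of_lt (MeromorphicAt.const _ _), ← orderAtInfty,
    orderAtInfty_hauptmodul]
  rw [← orderAtInfty, orderAtInfty_hauptmodul, meromorphicOrderAt_const]
  split_ifs
  · exact WithTop.coe_lt_top _
  · exact_mod_cast neg_one_lt_zero

/-- The ramification index of the Hauptmodul on an orbit. -/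
def ramification (x : Orbits 2) : ℤ := (orderOnOrbit 2 (shifted x) x).untop₀

lemma orderAt_shifted_orbit (z : ℍ) :
    orderAt (shifted (orbit 2 z)) z = (ramification (orbit 2 z) : ℤ) := by
  rw [ramification, (isModularFunction_shifted _).orderOnOrbit_orbit, WithTop.coe_untop₀_of_ne_top]
  exact (isModularFunction_shifted _).orderAt_ne_top (by simp [orderAtInfty_shifted]) z

lemma ramification_pos (x : Orbits 2) : 0 < ramification x := by
  obtain ⟨z, rfl⟩ : ∃ z, orbit 2 z = x := ⟨_, orbit_out x⟩
  have h : 0 < orderAt (shifted (orbit 2 z)) z := by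
    refine (tendsto_zero_iff_meromorphicOrderAt_pos (analyticAt_shifted _ z).meromorphicAt).mp ?_
    have := (analyticAt_shifted (orbit 2 z) z).continuousAt.tendsto
    have h0 : (shifted (orbit 2 z) ∘ ofComplex) z = 0 := by simp [shifted, hauptmodul_out]
    rw [h0] at this
    exact this.mono_left nhdsWithin_le_nhds
  rw [orderAt_shifted_orbit] at h
  exact_mod_cast h

open Classical in
lemma orderAt_shifted (x : Orbits 2) (z : ℍ) :
    orderAt (shifted x) z = ((if orbit 2 z = x then ramification x else 0 : ℤ) : WithTop ℤ) := by
  split_ifs with h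
  · rw [← h, orderAt_shifted_orbit]
  · refine meromorphicOrderAt_eq_zero (analyticAt_shifted x z) fun h0 => h ?_
    simp only [comp_apply, ofComplex_apply, shifted, sub_eq_zero] at h0
    rw [orbit_eq_of_hauptmodul_eq h0, orbit_out]

/-- The valence formula in terms of the ramification indices of the Hauptmodul. -/
theorem IsModularFunction.valence_ramification (hf : IsModularFunction 2 k f)
    (h0 : orderAtInfty f ≠ ⊤) (S : Finset (Orbits 2))
    (hS : ∀ x ∉ S, orderOnOrbit 2 f x = 0) :
    ((orderAtInfty f).untop₀ : ℚ) +
      ∑ x ∈ S, ((orderOnOrbit 2 f x).untop₀ : ℚ) / (ramification x : ℚ) = (k : ℚ) / 8 := by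
  classical
  have h1 := hf.orderAt_ne_top h0
  set n : Orbits 2 → ℤ := fun x => (orderOnOrbit 2 f x).untop₀ with hn
  have hnz : ∀ z, orderAt f z = (n (orbit 2 z) : WithTop ℤ) := fun z => by
    simp only [hn]
    rw [hf.orderOnOrbit_orbit, WithTop.coe_untop₀_of_ne_top (h1 z)]
  obtain ⟨v, hv⟩ := WithTop.ne_top_iff_exists.mp h0
  rw [← hv]
  -- The auxiliary function is f^(24M) · `deltaForm`^(−kM) · ∏ (t − t(x))^(−e x). The 24 cancels the
  -- weight, and the factor M keeps the exponents e x = 24 n x M / `ramification x` integral.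
  set M : ℤ := ∏ x ∈ S, ramification x with hM
  set e : Orbits 2 → ℤ := fun x => 24 * n x * ∏ y ∈ S.erase x, ramification y with he
  have heM : ∀ x ∈ S, e x * ramification x = 24 * n x * M := fun x hx => by
    rw [he, hM, ← Finset.mul_prod_erase S _ hx]
    ring
  have hM0 : M ≠ 0 := Finset.prod_ne_zero_iff.mpr fun x _ => (ramification_pos x).ne'
  have hF : ∀ x ∈ S, IsModularFunction 2 0 (shifted x ^ (-e x)) := fun x _ => by
    simpa using (isModularFunction_shifted x).zpow (-e x)
  have hA := hf.zpow (24 * M)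
  have hB := isModularFunction_deltaForm.zpow (-(k * M))
  have hC := IsModularFunction.prod hF
  have hAB := hA.mul hB
  rw [show k * (24 * M) + 24 * (-(k * M)) = 0 by ring] at hAB
  have hAll := hAB.mul hC
  rw [add_zero] at hAll
  have key := hAll.orderAtInfty_eq_zero fun z => by
    rw [hAB.orderAt_mul hC, hA.orderAt_mul hB, hf.orderAt_zpow,
      isModularFunction_deltaForm.orderAt_zpow, orderAt_deltaForm,
      IsModularFunction.orderAt_prod hF, hnz]
    have : ∀ x ∈ S, orderAt (shifted x ^ (-e x)) z =
        ((-e x * if orbit 2 z = x then ramification x else 0 : ℤ) : WithTop ℤ) := fun x _ => by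
      rw [(isModularFunction_shifted x).orderAt_zpow, orderAt_shifted]
      norm_cast
    rw [Finset.sum_congr rfl this, mul_zero, add_zero]
    norm_cast
    simp only [mul_ite, mul_zero]
    rw [Finset.sum_ite_eq]
    split_ifs with hz
    · have := heM _ hz
      linarith
    · have : n (orbit 2 z) = 0 := by simp [hn, hS _ hz]
      simp [this]
  rw [hAB.orderAtInfty_mul hC, hA.orderAtInfty_mul hB, hf.orderAtInfty_zpow,
    isModularFunction_deltaForm.orderAtInfty_zpow, orderAtInfty_deltaForm,
    IsModularFunction.orderAtInfty_prod hF, ← hv] at key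
  have : ∀ x ∈ S, orderAtInfty (shifted x ^ (-e x)) = ((e x : ℤ) : WithTop ℤ) := fun x _ => by
    rw [(isModularFunction_shifted x).orderAtInfty_zpow, orderAtInfty_shifted]
    norm_cast
    simp
  rw [Finset.sum_congr rfl this, show (3 : WithTop ℤ) = ((3 : ℤ) : WithTop ℤ) from rfl] at key
  norm_cast at key
  -- The 3 is the order of `deltaForm` at ∞; division by 24M turns it into k/8.
  have keyQ : (24 * M * v - k * M * 3 : ℚ) + ∑ x ∈ S, (e x : ℚ) = 0 := by
    have := congrArg (Int.cast : ℤ → ℚ) key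
    push_cast at this
    linarith
  have hMQ : (M : ℚ) ≠ 0 := by exact_mod_cast hM0
  have hsum : ∑ x ∈ S, (e x : ℚ) = 24 * M * ∑ x ∈ S, (n x : ℚ) / (ramification x : ℚ) := by
    rw [Finset.mul_sum]
    refine Finset.sum_congr rfl fun x hx => ?_
    have hr : (ramification x : ℚ) ≠ 0 := by exact_mod_cast (ramification_pos x).ne'
    have := congrArg (Int.cast : ℤ → ℚ) (heM x hx)
    push_cast at this
    field_simp
    linarith
  rw [hsum] at keyQ
  have : (M : ℚ) * ((v : ℚ) + ∑ x ∈ S, (n x : ℚ) / (ramification x : ℚ) - k / 8) = 0 := by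
    linarith
  have := (mul_eq_zero.mp this).resolve_left hMQ
  simp only [WithTop.untop₀_coe]
  linarith

/-- The derivative of the Hauptmodul. -/
def hauptmodulDeriv (z : ℍ) : ℂ := deriv (hauptmodul ∘ ofComplex) z

lemma hauptmodulDeriv_comp (z : ℍ) :
    hauptmodulDeriv ∘ ofComplex =ᶠ[𝓝 (z : ℂ)] deriv (hauptmodul ∘ ofComplex) := by
  filter_upwards [eventually_im_pos z] with w hw
  simp [hauptmodulDeriv, ofComplex_apply_of_im_pos hw]

lemma analyticAt_hauptmodulDeriv (z : ℍ) : AnalyticAt ℂ (hauptmodulDeriv ∘ ofComplex) z :=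
  (analyticAt_hauptmodul z).deriv.congr (hauptmodulDeriv_comp z).symm

lemma hauptmodulDeriv_smul {γ : SL(2, ℝ)} (hγ : γ ∈ Gamma0Star 2) (z : ℍ) :
    hauptmodulDeriv (γ • z) =
      (((γ 1 0 : ℝ) : ℂ) * (z : ℂ) + ((γ 1 1 : ℝ) : ℂ)) ^ (2 : ℤ) * hauptmodulDeriv z := by
  have h1 := (hasStrictDerivAt_smul γ z).hasDerivAt
  have h2 : HasDerivAt (hauptmodul ∘ ofComplex) (hauptmodulDeriv (γ • z))
      ((fun w : ℂ => ((γ • ofComplex w : ℍ) : ℂ)) z) := by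
    simp only [ofComplex_apply]
    exact (analyticAt_hauptmodul (γ • z)).differentiableAt.hasDerivAt
  have h3 := (h2.comp (z : ℂ) h1).deriv
  have e : (hauptmodul ∘ ofComplex) ∘ (fun w : ℂ => ((γ • ofComplex w : ℍ) : ℂ)) =
      hauptmodul ∘ ofComplex := by
    ext w
    simp [hauptmodul_smul hγ]
  rw [e] at h3
  rw [hauptmodulDeriv, hauptmodulDeriv] at *
  rw [h3]
  have := denom_ne_zero' γ z
  norm_cast
  field_simp

lemma cuspFunction_hauptmodulDeriv : cuspFunction 1 hauptmodulDeriv =ᶠ[𝓝[≠] 0]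
    fun q => (2 * Real.pi * Complex.I) * (q * deriv (cuspFunction 1 hauptmodul) q) := by
  filter_upwards [self_mem_nhdsWithin,
    nhdsWithin_le_nhds (Metric.ball_mem_nhds (0 : ℂ) one_pos)] with q hq hq1
  have hq1 : ‖q‖ < 1 := by simpa using hq1
  have him := Function.Periodic.im_invQParam_pos_of_norm_lt_one one_pos hq1 hq
  have hr := Function.Periodic.qParam_right_inv (h := 1) one_ne_zero hq
  rw [cuspFunction_of_ne_zero _ hq, hauptmodulDeriv, ofComplex_apply_of_im_pos him]
  set w := Function.Periodic.invQParam 1 q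
  have hd := isModularFunction_hauptmodul.periodic.differentiableAt_cuspFunction one_ne_zero
      (analyticAt_hauptmodul ⟨w, him⟩).differentiableAt
  have h := (HasDerivAt.comp w hd.hasDerivAt (hasDerivAt_qParam w)).deriv
  change deriv (cuspFunction 1 hauptmodul ∘ 𝕢) w = _ at h
  rw [cuspFunction_comp_qParam isModularFunction_hauptmodul.periodic] at h
  change deriv (hauptmodul ∘ ofComplex) w = _
  rw [h]
  change deriv (cuspFunction 1 hauptmodul) (𝕢 w) * _ = _
  rw [hr]
  ring

lemma isModularFunction_hauptmodulDeriv : IsModularFunction 2 2 hauptmodulDeriv where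
  meromorphicAt z := (analyticAt_hauptmodulDeriv z).meromorphicAt
  transform _ hγ z := hauptmodulDeriv_smul hγ z
  meromorphicAt_infty := ((MeromorphicAt.const (2 * Real.pi * Complex.I) _).mul
    ((MeromorphicAt.id 0).mul isModularFunction_hauptmodul.meromorphicAt_infty.deriv)).congr
      cuspFunction_hauptmodulDeriv.symm

lemma orderAtInfty_hauptmodulDeriv : orderAtInfty hauptmodulDeriv = (-1 : ℤ) := by
  have hm := isModularFunction_hauptmodul.meromorphicAt_infty.deriv
  have hd := meromorphicOrderAt_deriv_eq_sub_one (f := cuspFunction 1 hauptmodul) (x := 0)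
    (n := -1) (by norm_num) orderAtInfty_hauptmodul
  rw [orderAtInfty, meromorphicOrderAt_congr cuspFunction_hauptmodulDeriv]
  refine (meromorphicOrderAt_mul_of_ne_zero (g := fun _ => 2 * Real.pi * Complex.I)
    (f := fun q => q * deriv (cuspFunction 1 hauptmodul) q) analyticAt_const
    Complex.two_pi_I_ne_zero).trans ?_
  refine (meromorphicOrderAt_mul (MeromorphicAt.id 0) hm).trans ?_
  rw [show (fun q : ℂ => q) = id from rfl, meromorphicOrderAt_id, hd]
  rfl

/-- Subtracting a constant does not change the derivative, and differentiation lowers a nonzero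
order by one. -/
lemma orderAt_hauptmodulDeriv (z : ℍ) :
    orderAt hauptmodulDeriv z = ((ramification (orbit 2 z) - 1 : ℤ) : WithTop ℤ) := by
  rw [orderAt, meromorphicOrderAt_congr
    ((hauptmodulDeriv_comp z).filter_mono nhdsWithin_le_nhds),
    ← meromorphicOrderAt_deriv_eq_sub_one (f := shifted (orbit 2 z) ∘ ofComplex)
      (by exact_mod_cast (ramification_pos _).ne') (orderAt_shifted_orbit z)]
  congr 1
  ext w
  exact (deriv_sub_const (f := hauptmodul ∘ ofComplex) _).symm

/-- The multiplier of a stabilizing element is a root of unity of order dividing the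
ramification index. -/
lemma multiplier_zpow_ramification {γ : SL(2, ℝ)} (hγ : γ ∈ Gamma0Star 2) {z : ℍ}
    (hz : γ • z = z) :
    ((((γ 1 0 : ℝ) : ℂ) * z + ((γ 1 1 : ℝ) : ℂ)) ^ 2)⁻¹ ^ ramification (orbit 2 z) = 1 := by
  set m := ramification (orbit 2 z)
  obtain ⟨g, hg, hg0, h⟩ := (meromorphicOrderAt_eq_int_iff
    (analyticAt_shifted (orbit 2 z) z).meromorphicAt).mp (orderAt_shifted_orbit z)
  have hd := (hasStrictDerivAt_smul γ z).hasDerivAt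
  have hd0 : ((((γ 1 0 : ℝ) : ℂ) * z + ((γ 1 1 : ℝ) : ℂ)) ^ 2)⁻¹ ≠ 0 :=
    inv_ne_zero (pow_ne_zero _ (denom_ne_zero' γ z))
  set N : ℂ → ℂ := fun w : ℂ => ((γ • ofComplex w : ℍ) : ℂ) with hN
  have hNz : N z = z := by simp [hN, hz]
  have hslope := (hasDerivAt_iff_tendsto_slope.mp hd).zpow₀ m (Or.inl hd0)
  have hNt : Tendsto N (𝓝[≠] (z : ℂ)) (𝓝[≠] (z : ℂ)) := by
    have := hd.tendsto_nhdsNE hd0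
    rwa [hNz] at this
  have hlim1 := hslope.mul ((hg.continuousAt.tendsto.mono_left nhdsWithin_le_nhds).comp hNt)
  have hlim2 := hg.continuousAt.tendsto.mono_left (nhdsWithin_le_nhds (s := {(z : ℂ)}ᶜ))
  -- Invariance reads (N w − z)^m g(N w) = (w − z)^m g(w). Dividing by (w − z)^m and letting w → z
  -- shows that N'(z)^m = 1, since g(z) ≠ 0.
  have heq : (fun w => slope N z w ^ m * (g ∘ N) w) =ᶠ[𝓝[≠] (z : ℂ)] g := by
    filter_upwards [h, hNt.eventually h, self_mem_nhdsWithin] with w hw hw' hwz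
    have hwz' : w - z ≠ 0 := sub_ne_zero.mpr hwz
    have e : (shifted (orbit 2 z) ∘ ofComplex) (N w) = (shifted (orbit 2 z) ∘ ofComplex) w := by
      simp [hN, shifted, hauptmodul_smul hγ]
    rw [hw, hw'] at e
    rw [slope_def_field, hNz, div_zpow, comp_apply]
    simp only [smul_eq_mul] at e
    rw [div_mul_eq_mul_div, e, mul_div_cancel_left₀ _ (zpow_ne_zero _ hwz')]
  have := tendsto_nhds_unique (hlim1.congr' heq) hlim2
  exact mul_right_cancel₀ hg0 (by rw [this, one_mul])

/-- W₂ fixes i/√2 with multiplier −1. -/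
lemma two_dvd_ramification : (2 : ℤ) ∣ ramification (orbit 2 iPoint) := by
  have h := multiplier_zpow_ramification W_mem W_smul_iPoint
  have h2 : ((√2 : ℝ) : ℂ) ≠ 0 := by simp
  rw [denom_W, coe_iPoint, mul_div_cancel₀ _ h2, Complex.I_sq, inv_neg, inv_one] at h
  rw [← even_iff_two_dvd]
  by_contra ho
  rw [(Int.not_even_iff_odd.mp ho).neg_one_zpow] at h
  norm_num at h

/-- The map z ↦ W₂z − 1 fixes ρ₂ with multiplier i, a primitive fourth root of unity. -/
lemma four_dvd_ramification : (4 : ℤ) ∣ ramification (orbit 2 rhoPoint) := by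
  have h := multiplier_zpow_ramification (mul_mem (translation_mem (-1)) W_mem)
    translation_W_smul_rhoPoint
  have e0 : (translation (-1) * W 2) 1 0 = √2 := by
    rw [Matrix.SpecialLinearGroup.coe_mul, coe_W, coe_translation]
    simp [Matrix.mul_apply, Fin.sum_univ_two]
  have e1 : (translation (-1) * W 2) 1 1 = 0 := by
    rw [Matrix.SpecialLinearGroup.coe_mul, coe_W, coe_translation]
    simp [Matrix.mul_apply, Fin.sum_univ_two]
  have h2 : ((√2 : ℝ) : ℂ) ^ 2 = 2 := by exact_mod_cast Real.sq_sqrt (by norm_num : (0 : ℝ) ≤ 2)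
  have e2 : ((((√2 : ℝ) : ℂ) * rhoPoint + ((0 : ℝ) : ℂ)) ^ 2)⁻¹ = Complex.I := by
    rw [coe_rhoPoint, Complex.ofReal_zero, add_zero, mul_pow, h2]
    rw [inv_eq_iff_eq_inv, Complex.inv_I]
    linear_combination Complex.I_sq / 2
  rw [e0, e1, e2] at h
  have hp : IsPrimitiveRoot Complex.I 4 := Complex.isPrimitiveRoot_I
  exact_mod_cast (hp.zpow_eq_one_iff_dvd _).mp h

/-- The Riemann–Hurwitz formula for the Hauptmodul determines its ramification. -/
theorem ramification_eq : ramification (orbit 2 iPoint) = 2 ∧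
    ramification (orbit 2 rhoPoint) = 4 ∧
    ∀ x, x ≠ orbit 2 iPoint → x ≠ orbit 2 rhoPoint → ramification x = 1 := by
  classical
  have hD := isModularFunction_hauptmodulDeriv
  have hinf : orderAtInfty hauptmodulDeriv ≠ ⊤ := by simp [orderAtInfty_hauptmodulDeriv]
  have hfin := hD.finite_order_ne_zero (hD.orderAt_ne_top hinf)
  have hord : ∀ x, orderOnOrbit 2 hauptmodulDeriv x = ((ramification x - 1 : ℤ) : WithTop ℤ) :=
    fun x => by rw [orderOnOrbit, orderAt_hauptmodulDeriv, orbit_out]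
  set a := orbit 2 iPoint with ha
  set b := orbit 2 rhoPoint with hb
  have hab : a ≠ b := orbit_iPoint_ne_orbit_rhoPoint
  set S := insert a (insert b hfin.toFinset) with hS
  have hSnot : ∀ x ∉ S, orderOnOrbit 2 hauptmodulDeriv x = 0 := fun x hx => by
    by_contra h
    exact hx (by simp [hS, h])
  -- For the derivative, of weight 2 and order −1 at ∞, this reads −1 + ∑ (1 − 1/e_x) = 1/4.
  have h := hD.valence_ramification hinf S hSnot
  have haS : a ∈ S := by simp [hS]
  have hbS : b ∈ S.erase a := by simp [hS, hab.symm]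
  rw [← Finset.add_sum_erase _ _ haS, ← Finset.add_sum_erase _ _ hbS,
    orderAtInfty_hauptmodulDeriv] at h
  simp only [hord, WithTop.untop₀_coe] at h
  have hpos : ∀ x, (1 : ℚ) ≤ ramification x := fun x => by
    exact_mod_cast (show (1 : ℤ) ≤ _ from ramification_pos x)
  have hnn : ∀ x, (0 : ℚ) ≤ ((ramification x - 1 : ℤ) : ℚ) / (ramification x : ℚ) := fun x => by
    have := hpos x
    push_cast
    exact div_nonneg (by linarith) (by linarith)
  have hsum := Finset.sum_nonneg (s := (S.erase a).erase b) fun x _ => hnn x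
  have ha2 : (2 : ℚ) ≤ ramification a := by
    exact_mod_cast Int.le_of_dvd (ramification_pos a) two_dvd_ramification
  have hb4 : (4 : ℚ) ≤ ramification b := by
    exact_mod_cast Int.le_of_dvd (ramification_pos b) four_dvd_ramification
  -- Each special term is split into its least possible value, 1/2 or 3/4, and a nonnegative excess.
  -- The least values already sum to 5/4, so both excesses and all remaining terms vanish.
  have hA : ((ramification a - 1 : ℤ) : ℚ) / (ramification a : ℚ) =
      1 / 2 + (ramification a - 2) / (2 * ramification a) := by
    have := (by linarith : (ramification a : ℚ) ≠ 0 )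
    push_cast
    field_simp
    ring
  have hB : ((ramification b - 1 : ℤ) : ℚ) / (ramification b : ℚ) =
      3 / 4 + (ramification b - 4) / (4 * ramification b) := by
    have := (by linarith : (ramification b : ℚ) ≠ 0 )
    push_cast
    field_simp
    ring
  have hA0 : (0 : ℚ) ≤ (ramification a - 2) / (2 * ramification a) :=
    div_nonneg (by linarith) (by linarith)
  have hB0 : (0 : ℚ) ≤ (ramification b - 4) / (4 * ramification b) :=
    div_nonneg (by linarith) (by linarith)
  rw [hA, hB] at h
  push_cast at h hsum
  have hA1 : ((ramification a : ℚ) - 2) / (2 * ramification a) = 0 := by linarith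
  have hB1 : ((ramification b : ℚ) - 4) / (4 * ramification b) = 0 := by linarith
  have hs1 : ∑ x ∈ (S.erase a).erase b, ((ramification x : ℚ) - 1) / ramification x = 0 := by
    linarith
  refine ⟨?_, ?_, fun x hxa hxb => ?_⟩
  · rcases div_eq_zero_iff.mp hA1 with h | h
    · exact_mod_cast (by linarith : (ramification a : ℚ) = 2)
    · linarith
  · rcases div_eq_zero_iff.mp hB1 with h | h
    · exact_mod_cast (by linarith : (ramification b : ℚ) = 4)
    · linarith
  · by_cases hx : x ∈ S
    · have := (Finset.sum_eq_zero_iff_of_nonneg (fun x _ => by simpa using hnn x)).mp hs1 x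
        (by simp [hxa, hxb, hx])
      rcases div_eq_zero_iff.mp this with h | h
      · exact_mod_cast (by linarith : (ramification x : ℚ) = 1)
      · linarith [hpos x]
    · have := hSnot x hx
      rw [hord] at this
      have : ramification x - 1 = 0 := by exact_mod_cast this
      linarith

end

end Fricke
end

theorem mainTheorem3 (k : ℤ) (f : ℍ → ℂ) (hf : Fricke.IsModularFunction 2 k f)
    (hf0 : ¬ f =ᶠ[Filter.codiscrete ℍ] 0) :
    Fricke.orderAtInfty f ≠ ⊤ ∧
    (∀ z : ℍ, Fricke.orderAt f z ≠ ⊤) ∧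
    (∀ γ ∈ Fricke.Gamma0Star 2, ∀ z : ℍ,
      Fricke.orderAt f (γ • z) = Fricke.orderAt f z) ∧
    {x : Fricke.Orbits 2 | Fricke.orderOnOrbit 2 f x ≠ 0}.Finite ∧
    ((Fricke.orderAtInfty f).untop₀ : ℚ)
      + 1 / 2 * ((Fricke.orderAt f Fricke.iPoint).untop₀ : ℚ)
      + 1 / 4 * ((Fricke.orderAt f Fricke.rhoPoint).untop₀ : ℚ)
      + ∑ᶠ (x : Fricke.Orbits 2) (_ : x ≠ Fricke.orbit 2 Fricke.iPoint ∧
          x ≠ Fricke.orbit 2 Fricke.rhoPoint), ((Fricke.orderOnOrbit 2 f x).untop₀ : ℚ)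
      = (k : ℚ) / 8 := by
  classical
  obtain ⟨hinf, hz⟩ := hf.order_ne_top hf0
  have hfin := hf.finite_order_ne_zero hz
  refine ⟨hinf, hz, fun γ hγ z => hf.orderAt_smul hγ z, hfin, ?_⟩
  obtain ⟨ra, rb, r1⟩ := Fricke.ramification_eq
  have hoa := hf.orderOnOrbit_orbit Fricke.iPoint
  have hob := hf.orderOnOrbit_orbit Fricke.rhoPoint
  have hab := Fricke.orbit_iPoint_ne_orbit_rhoPoint
  set a := Fricke.orbit 2 Fricke.iPoint
  set b := Fricke.orbit 2 Fricke.rhoPoint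
  set S := insert a (insert b hfin.toFinset) with hS
  have h := hf.valence_ramification hinf S fun x hx => by
    by_contra h
    exact hx (by simp [hS, h])
  have haS : a ∈ S := by simp [hS]
  have hbS : b ∈ S.erase a := by simp [hS, hab.symm]
  rw [← Finset.add_sum_erase _ _ haS, ← Finset.add_sum_erase _ _ hbS, ra, rb, hoa, hob] at h
  have hsum : ∑ᶠ (x : Fricke.Orbits 2) (_ : x ≠ a ∧ x ≠ b),
      ((Fricke.orderOnOrbit 2 f x).untop₀ : ℚ) =
      ∑ x ∈ (S.erase a).erase b,
        ((Fricke.orderOnOrbit 2 f x).untop₀ : ℚ) / (Fricke.ramification x : ℚ) := by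
    rw [finsum_congr fun x => finsum_eq_if]
    rw [finsum_eq_sum_of_support_subset (s := (S.erase a).erase b)]
    · refine Finset.sum_congr rfl fun x hx => ?_
      simp only [Finset.mem_erase] at hx
      rw [if_pos ⟨hx.2.1, hx.1⟩, r1 x hx.2.1 hx.1]
      simp
    · intro x hx
      rw [Function.mem_support, ne_eq, ite_eq_right_iff, Classical.not_imp] at hx
      obtain ⟨⟨hxa, hxb⟩, hx⟩ := hx
      have : Fricke.orderOnOrbit 2 f x ≠ 0 := fun h0 => hx (by simp [h0])
      simp [hS, hxa, hxb, this]
  rw [hsum]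
  push_cast at h
  linarith
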